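/- Let $k$ be an algebraically closed field of characteristic $p>2$, let $n\ge 0$, and let $(\cdot\,,\cdot)$ be a non-degenerate symmetric bilinear form on $V=k^n$. Let $G=\mathrm{O}_n(k)\subseteq \mathrm{GL}_n(k)$ be the group of all invertible matrices preserving this form, let $\mathfrak g=\mathfrak{so}_n(k)=\operatorname{Lie}(G)$ be the Lie algebra of all $n\times n$ matrices $x$ with $(xv,w)+(v,xw)=0$ for all $v,w\in V$, on which $G$ acts by conjugation, and let $\mathcal N$ be the set of nilpotent matrices in $\mathfrak g$. For $x\in\mathcal N$ let $\lambda(x)=(\lambda_1\ge\lambda_2\ge\cdots)$ be the partition of $n$ given by the sizes of the Jordan blocks of $x$ (with $\lambda_i=0$ beyond the last part), and put $${}^1\mathcal N^p:=\{x\in\mathcal N \mid \lambda(x)=(\lambda_1,\lambda_2,\dots),\ \lambda_1\le p,\ \lambda_2<p\}.$$ An $\mathfrak{sl}_2$-triple in $\mathfrak g$ is a triple $(e,h,f)$ of elements of $\mathfrak g$ with $[h,e]=2e$, $[h,f]=-2f$ and $[e,f]=h$ (the zero triple is allowed). Then ${}^1\mathcal N^p$ satisfies the $\mathfrak{sl}_2$-property.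 That is, ${}^1\mathcal N^p$ is a $G$-stable Zariski closed subset of $\mathcal N$, and the map $$\{G\text{-orbits of }\mathfrak{sl}_2\text{-triples }(e,h,f)\text{ in }\mathfrak g\text{ with }e,f\in{}^1\mathcal N^p\}\longrightarrow\{G\text{-orbits in }{}^1\mathcal N^p\}$$ sending the $G$-orbit of $(e,h,f)$ to the $G$-orbit of $e$ is a bijection. -/

import Mathlib

attribute [local instance] LieRing.ofAssociativeRing

section Sl2Property

open Matrix

variable {k : Type*} [Field k] {n : ℕ}

/-- The orthogonal group of the symmetric bilinear form `(v, w) ↦ vᵀ S w` on `kⁿ`: all invertible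
matrices that preserve the form. -/
def orthogonalGroupOf (S : Matrix (Fin n) (Fin n) k) : Subgroup (GL (Fin n) k) where
  carrier := {g | (g : Matrix (Fin n) (Fin n) k)ᵀ * S * (g : Matrix (Fin n) (Fin n) k) = S}
  one_mem' := by simp
  mul_mem' := by
    intro a b ha hb
    simp only [Set.mem_ofPred_eq, Units.val_mul, transpose_mul] at ha hb ⊢
    calc _ = (b : Matrix (Fin n) (Fin n) k)ᵀ *
          ((a : Matrix (Fin n) (Fin n) k)ᵀ * S * (a : Matrix (Fin n) (Fin n) k)) *
          (b : Matrix (Fin n) (Fin n) k) := by simp only [Matrix.mul_assoc]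
      _ = S := by rw [ha, hb]
  inv_mem' := by
    intro a ha
    simp only [Set.mem_ofPred_eq] at ha ⊢
    have h1 : (a : Matrix (Fin n) (Fin n) k) * ((a⁻¹ : GL (Fin n) k) : Matrix (Fin n) (Fin n) k)
        = 1 := by rw [← Units.val_mul, mul_inv_cancel, Units.val_one]
    have h2 : ((a⁻¹ : GL (Fin n) k) : Matrix (Fin n) (Fin n) k)ᵀ *
        (a : Matrix (Fin n) (Fin n) k)ᵀ = 1 := by rw [← transpose_mul, h1, transpose_one]
    conv_lhs => rw [← ha]
    calc _ = (((a⁻¹ : GL (Fin n) k) : Matrix (Fin n) (Fin n) k)ᵀ *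
          (a : Matrix (Fin n) (Fin n) k)ᵀ) * S * ((a : Matrix (Fin n) (Fin n) k) *
          ((a⁻¹ : GL (Fin n) k) : Matrix (Fin n) (Fin n) k)) := by simp only [Matrix.mul_assoc]
      _ = S := by rw [h1, h2, Matrix.one_mul, Matrix.mul_one]

/-- The adjoint action of an invertible matrix, `x ↦ g x g⁻¹`. -/
def adAction (g : GL (Fin n) k) (x : Matrix (Fin n) (Fin n) k) : Matrix (Fin n) (Fin n) k :=
  (g : Matrix (Fin n) (Fin n) k) * x * ((g⁻¹ : GL (Fin n) k) : Matrix (Fin n) (Fin n) k)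

theorem adAction_one (x : Matrix (Fin n) (Fin n) k) : adAction 1 x = x := by
  simp [adAction]

theorem adAction_mul (g g' : GL (Fin n) k) (x : Matrix (Fin n) (Fin n) k) :
    adAction (g * g') x = adAction g (adAction g' x) := by
  simp only [adAction, _root_.mul_inv_rev, Units.val_mul, Matrix.mul_assoc]

theorem adAction_inv_cancel (g : GL (Fin n) k) (x : Matrix (Fin n) (Fin n) k) :
    adAction g⁻¹ (adAction g x) = x := by
  rw [← adAction_mul, inv_mul_cancel, adAction_one]

/-- The nilpotent cone of a Lie algebra of matrices. -/
def nilpotentCone (𝔤 : LieSubalgebra k (Matrix (Fin n) (Fin n) k)) :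
    Set (Matrix (Fin n) (Fin n) k) :=
  {x | x ∈ 𝔤 ∧ IsNilpotent x}

/-- The nilpotent Jordan block of size `d`, with ones on the superdiagonal and zeros elsewhere. -/
def nilpotentJordanBlock (k : Type*) [Field k] (d : ℕ) : Matrix (Fin d) (Fin d) k :=
  Matrix.of fun i j => if (i : ℕ) + 1 = (j : ℕ) then 1 else 0

/-- The parts of a partition, listed in weakly decreasing order. -/
def partList (lam : n.Partition) : List ℕ := lam.parts.sort (· ≥ ·)

/-- The `i`-th part (`i = 1, 2, …`) in weakly decreasing order; it is `0` beyond the last part. -/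
def nthPart (lam : n.Partition) (i : ℕ) : ℕ := (partList lam).getD (i - 1) 0

/-- `x ∼ lam`: the Jordan normal form of `x` is the block diagonal matrix whose blocks are
nilpotent Jordan blocks of sizes the parts of `lam`. The bijection `σ` only identifies the
positions in the blocks with `1, …, n`. -/
def HasJordanType (x : Matrix (Fin n) (Fin n) k) (lam : n.Partition) : Prop :=
  ∃ (σ : (Σ i : Fin (partList lam).length, Fin ((partList lam).get i)) ≃ Fin n)
    (g : GL (Fin n) k),
    x = adAction g (Matrix.reindex σ σ
      (Matrix.blockDiagonal' fun i => nilpotentJordanBlock k ((partList lam).get i)))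

/-- The set `¹𝒩ᵖ` of nilpotent elements of `𝔤` of Jordan type `(λ₁, λ₂, …)` with `λ₁ ≤ p`
and `λ₂ < p`. -/
def oneNp (𝔤 : LieSubalgebra k (Matrix (Fin n) (Fin n) k)) (p : ℕ) :
    Set (Matrix (Fin n) (Fin n) k) :=
  {x | x ∈ nilpotentCone 𝔤 ∧
    ∃ lam : n.Partition, HasJordanType x lam ∧ nthPart lam 1 ≤ p ∧ nthPart lam 2 < p}

/-- `(e, h, f)` is an `𝔰𝔩₂`-triple in `𝔤`, i.e. the image of the standard basis of `𝔰𝔩₂(k)` under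
a Lie algebra homomorphism to `𝔤`. The zero triple is allowed. -/
structure IsSl2TripleIn (𝔤 : LieSubalgebra k (Matrix (Fin n) (Fin n) k))
    (e h f : Matrix (Fin n) (Fin n) k) : Prop where
  e_mem : e ∈ 𝔤
  h_mem : h ∈ 𝔤
  f_mem : f ∈ 𝔤
  lie_h_e : ⁅h, e⁆ = (2 : k) • e
  lie_h_f : ⁅h, f⁆ = -((2 : k) • f)
  lie_e_f : ⁅e, f⁆ = h

/-- The `𝔰𝔩₂`-triples `(e, h, f)` in `𝔤` with `e` and `f` in `𝒱`. -/
structure Sl2TripleIn (𝔤 : LieSubalgebra k (Matrix (Fin n) (Fin n) k))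
    (𝒱 : Set (Matrix (Fin n) (Fin n) k)) where
  e : Matrix (Fin n) (Fin n) k
  h : Matrix (Fin n) (Fin n) k
  f : Matrix (Fin n) (Fin n) k
  isTriple : IsSl2TripleIn 𝔤 e h f
  e_mem : e ∈ 𝒱
  f_mem : f ∈ 𝒱

/-- Two elements of `𝒱` are related if they are conjugate under `G`. -/
def conjSetoid (G : Subgroup (GL (Fin n) k)) (𝒱 : Set (Matrix (Fin n) (Fin n) k)) :
    Setoid 𝒱 where
  r x y := ∃ g ∈ G, adAction g (x : Matrix (Fin n) (Fin n) k) = y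
  iseqv :=
    { refl := fun x => ⟨1, G.one_mem, adAction_one _⟩
      symm := by
        rintro x y ⟨g, hg, hxy⟩
        exact ⟨g⁻¹, G.inv_mem hg, by rw [← hxy, adAction_inv_cancel]⟩
      trans := by
        rintro x y z ⟨g, hg, hxy⟩ ⟨g', hg', hyz⟩
        exact ⟨g' * g, G.mul_mem hg' hg, by rw [adAction_mul, hxy, hyz]⟩ }

/-- Two `𝔰𝔩₂`-triples are related if they are simultaneously conjugate under `G`. -/
def tripleSetoid (G : Subgroup (GL (Fin n) k))
    (𝔤 : LieSubalgebra k (Matrix (Fin n) (Fin n) k)) (𝒱 : Set (Matrix (Fin n) (Fin n) k)) :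
    Setoid (Sl2TripleIn 𝔤 𝒱) where
  r s t := ∃ g ∈ G, adAction g s.e = t.e ∧ adAction g s.h = t.h ∧ adAction g s.f = t.f
  iseqv :=
    { refl := fun s => ⟨1, G.one_mem, adAction_one _, adAction_one _, adAction_one _⟩
      symm := by
        rintro s t ⟨g, hg, h1, h2, h3⟩
        exact ⟨g⁻¹, G.inv_mem hg, by rw [← h1, adAction_inv_cancel],
          by rw [← h2, adAction_inv_cancel], by rw [← h3, adAction_inv_cancel]⟩
      trans := by
        rintro s t u ⟨g, hg, h1, h2, h3⟩ ⟨g', hg', h1', h2', h3'⟩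
        exact ⟨g' * g, G.mul_mem hg' hg, by rw [adAction_mul, h1, h1'],
          by rw [adAction_mul, h2, h2'], by rw [adAction_mul, h3, h3']⟩ }

/-- The map from `G`-orbits of `𝔰𝔩₂`-triples `(e, h, f)` in `𝔤` with `e, f ∈ 𝒱` to `G`-orbits in
`𝒱` that sends the orbit of `(e, h, f)` to the orbit of `e`. -/
def kostantMap (G : Subgroup (GL (Fin n) k))
    (𝔤 : LieSubalgebra k (Matrix (Fin n) (Fin n) k)) (𝒱 : Set (Matrix (Fin n) (Fin n) k)) :
    Quotient (tripleSetoid G 𝔤 𝒱) → Quotient (conjSetoid G 𝒱) :=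
  Quotient.map (fun t => ⟨t.e, t.e_mem⟩) (by
    rintro s t ⟨g, hg, h1, -, -⟩
    exact ⟨g, hg, h1⟩)

/-- Zariski closed sets of matrices: common zero sets of polynomials in the matrix entries. -/
def IsZariskiClosed (𝒱 : Set (Matrix (Fin n) (Fin n) k)) : Prop :=
  ∃ I : Ideal (MvPolynomial (Fin n × Fin n) k),
    𝒱 = {x | (fun ij : Fin n × Fin n => x ij.1 ij.2) ∈ MvPolynomial.zeroLocus k I}

/-- `𝒱` satisfies the `𝔰𝔩₂`-property for `G` with Lie algebra `𝔤`: it is a `G`-stable closed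
subvariety of the nilpotent cone, and sending the `G`-orbit of an `𝔰𝔩₂`-triple `(e, h, f)` with
`e, f ∈ 𝒱` to the `G`-orbit of `e` is a bijection onto the set of `G`-orbits in `𝒱`. -/
structure HasSl2Property (G : Subgroup (GL (Fin n) k))
    (𝔤 : LieSubalgebra k (Matrix (Fin n) (Fin n) k)) (𝒱 : Set (Matrix (Fin n) (Fin n) k)) :
    Prop where
  subset_nilpotentCone : 𝒱 ⊆ nilpotentCone 𝔤
  stable : ∀ g ∈ G, ∀ x ∈ 𝒱, adAction g x ∈ 𝒱
  closed : IsZariskiClosed 𝒱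
  bijective : Function.Bijective (kostantMap G 𝔤 𝒱)

end Sl2Property

/-! Membership in `¹𝒩ᵖ` is a condition on powers: `x` is skew, `x ^ p = 0`, and `x ^ (p - 1)` has
rank at most one (`mem_oneNp_iff`). These are polynomial conditions, which gives closedness.
Bijectivity becomes a statement about skew operators on a quadratic space, proved by splitting off
orthogonal summands made of the longest strings.

Let `e ^ m ≠ 0 = e ^ (m + 1)`, so `m < p`. The heart is that in any admissible triple the image of
`e ^ m` has weight `m` (`h_pow_max`). For `m < p - 1` this follows from the commutator of `f` with
`e ^ (m + 1)`, since `m + 1` is invertible. For `m = p - 1` that commutator says nothing. But `p -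
1` is even, so `e ^ (p - 1)` is self-adjoint, and if its image is a line then skewness of `h` forces
the weight `-1 = p - 1`. This is where `λ₂ < p` enters.

Hence `e ^ m f ^ m e ^ m` is a nonzero multiple of `e ^ m`, and the image of `f ^ m` consists of
lowest weight vectors of weight `-m`. The form `(f ^ m x, e ^ m f ^ m y)` is nonzero and `(-1) ^
m`-symmetric. Over an algebraically closed field one can therefore choose generators whose strings
span a non-degenerate summand of a fixed shape, stable under the triple
(`IsOrthSl2.exists_chainFamily`). Two triples with the same ranks of all `e ^ i` have matching
summands, and induction on the orthogonal complement yields an isometry between them. This is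
injectivity.

For surjectivity, only `e` is given. A normalised family of strings of maximal length still exists
(`exists_chainFamily_of_skew`). On it `h` and `f` are defined by the formulas of the simple module
of dimension `m + 1`, and on the complement by induction. -/

/-! ### Triples of skew operators and their extreme weights -/

section Sl2Operators

open Module

variable {k V : Type*} [Field k] [AddCommGroup V] [Module k V]

/-- The endomorphism `x` is skew-adjoint with respect to `B`. -/
def IsSkewFor (B : LinearMap.BilinForm k V) (x : End k V) : Prop :=
  ∀ v w, B (x v) w = -B v (x w)

/-- The endomorphism `x` has rank at most one. -/
def IsRankLEOne (x : End k V) : Prop :=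
  ∀ v w, x v ≠ 0 → ∃ c : k, x w = c • x v

theorem IsRankLEOne.of_forall {x : End k V} (z : V) (hz : ∀ v, ∃ c : k, x v = c • z) :
    IsRankLEOne x := by
  intro v w hv
  obtain ⟨a, ha⟩ := hz v
  obtain ⟨b, hb⟩ := hz w
  have ha0 : a ≠ 0 := by
    rintro rfl
    exact hv (by rw [ha, zero_smul])
  exact ⟨b / a, by rw [ha, hb, smul_smul, div_mul_cancel₀ _ ha0]⟩

/-- The commutation relations of an `𝔰𝔩₂`-triple of endomorphisms. -/
structure IsSl2 (e h f : End k V) : Prop where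
  h_e : ∀ v, h (e v) = e (h v) + (2 : k) • e v
  h_f : ∀ v, h (f v) = f (h v) - (2 : k) • f v
  e_f : ∀ v, e (f v) = f (e v) + h v

theorem IsSkewFor.neg {B : LinearMap.BilinForm k V} {x : End k V} (hx : IsSkewFor B x) :
    IsSkewFor B (-x) := by
  intro v w
  simp [hx v w]

theorem IsSkewFor.pow {B : LinearMap.BilinForm k V} {x : End k V} (hx : IsSkewFor B x) (i : ℕ)
    (v w : V) : B ((x ^ i) v) w = (-1) ^ i * B v ((x ^ i) w) := by
  induction i generalizing v w with
  | zero => simp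
  | succ i ih =>
    rw [pow_succ, Module.End.mul_apply, ih, hx, ← Module.End.mul_apply, ← pow_succ', pow_succ]
    simp [pow_succ]

namespace IsSl2

variable {e h f : End k V}

/-- This symmetry turns every statement about `e` and highest weights into one about `f` and lowest
weights. -/
theorem swap (H : IsSl2 e h f) : IsSl2 f (-h) e where
  h_e v := by simp [H.h_f]; abel
  h_f v := by simp [H.h_e]; abel
  e_f v := by simp [H.e_f]

theorem h_pow_e (H : IsSl2 e h f) (i : ℕ) (v : V) :
    h ((e ^ i) v) = (e ^ i) (h v) + (2 * i : k) • (e ^ i) v := by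
  induction i generalizing v with
  | zero => simp
  | succ i ih =>
    rw [pow_succ, Module.End.mul_apply, ih, H.h_e, map_add, map_smul, Module.End.mul_apply]
    push_cast
    module

/-- When `i + 1 = p` both correction coefficients vanish in `k`; this is why the power `e ^ (p - 1)`
needs a separate argument for its weight. -/
theorem f_pow_e (H : IsSl2 e h f) (i : ℕ) (v : V) :
    f ((e ^ (i + 1)) v) = (e ^ (i + 1)) (f v) - (i + 1 : k) • (e ^ i) (h v)
      - ((i + 1) * i : k) • (e ^ i) v := by
  induction i generalizing v with
  | zero => simp [H.e_f]
  | succ i ih =>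
    have h1 := ih (e v)
    rw [← Module.End.mul_apply (e ^ (i + 1)) e, ← pow_succ, H.h_e, map_add, map_smul,
      ← Module.End.mul_apply (e ^ i) e, ← Module.End.mul_apply (e ^ i) e, ← pow_succ] at h1
    rw [h1, pow_succ _ (i + 1), Module.End.mul_apply (e ^ (i + 1)) e (f v), H.e_f, map_add]
    push_cast
    module

/-- The action of `f` on the string through a lowest weight vector of weight `-m`. -/
theorem f_string (H : IsSl2 e h f) {m : ℕ} {v : V} (hf : f v = 0) (hh : h v = -(m : k) • v)
    (i : ℕ) : f ((e ^ (i + 1)) v) = ((i + 1) * (m - i) : k) • (e ^ i) v := by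
  rw [H.f_pow_e, hf, hh, map_zero, map_smul]
  module

/-- The scalar by which `f ^ i e ^ i` acts on a lowest weight vector of weight `-m`. -/
theorem pow_f_pow_e (H : IsSl2 e h f) {m : ℕ} {v : V} (hf : f v = 0)
    (hh : h v = -(m : k) • v) (i : ℕ) :
    (f ^ i) ((e ^ i) v) = (∏ j ∈ Finset.range i, ((j + 1) * (m - j) : k)) • v := by
  induction i with
  | zero => simp
  | succ i ih =>
    rw [pow_succ, Module.End.mul_apply, H.f_string hf hh, map_smul, ih, Finset.prod_range_succ,
      smul_smul, mul_comm]

end IsSl2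

theorem natCast_ne_zero_of_lt (k : Type*) [Field k] {p : ℕ} [CharP k p] {i : ℕ} (h0 : 0 < i)
    (hi : i < p) : (i : k) ≠ 0 := fun h =>
  absurd (Nat.le_of_dvd h0 ((CharP.cast_eq_zero_iff k p i).1 h)) (by omega)

theorem two_ne_zero_of_charP (k : Type*) [Field k] {p : ℕ} [CharP k p] (hp : 2 < p) :
    (2 : k) ≠ 0 := by
  have := natCast_ne_zero_of_lt k (p := p) (i := 2) (by omega) hp
  exact_mod_cast this

theorem even_pred_of_charP (k : Type*) [Field k] {p : ℕ} [CharP k p] (hp : 2 < p) :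
    Even (p - 1) := by
  rcases CharP.char_is_prime_or_zero k p with h | h
  · exact h.even_sub_one (by omega)
  · omega

/-- For `j < i ≤ m < p` both `j + 1` and `m - j` lie strictly between `0` and `p`. -/
theorem prod_string_ne_zero (k : Type*) [Field k] {p : ℕ} [CharP k p] {m i : ℕ} (hm : m < p)
    (hi : i ≤ m) : (∏ j ∈ Finset.range i, ((j + 1) * (m - j) : k)) ≠ 0 := by
  rw [Finset.prod_ne_zero_iff]
  intro j hj
  have hj := Finset.mem_range.1 hj
  have h1 := natCast_ne_zero_of_lt k (p := p) (i := j + 1) (by omega) (by omega)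
  have h2 := natCast_ne_zero_of_lt k (p := p) (i := m - j) (by omega) (by omega)
  rw [Nat.cast_sub (by omega)] at h2
  push_cast at h1
  exact mul_ne_zero h1 h2

/-- An `𝔰𝔩₂`-triple of skew-adjoint endomorphisms of a non-degenerate quadratic space whose
nilpotent members satisfy the conditions defining `¹𝒩ᵖ`. -/
structure IsOrthSl2 (p : ℕ) (B : LinearMap.BilinForm k V) (e h f : End k V) : Prop
    extends IsSl2 e h f where
  symm : ∀ v w, B v w = B w v
  nondeg : ∀ v, (∀ w, B v w = 0) → v = 0
  skew_e : IsSkewFor B e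
  skew_h : IsSkewFor B h
  skew_f : IsSkewFor B f
  pow_e : e ^ p = 0
  pow_f : f ^ p = 0
  rank_e : IsRankLEOne (e ^ (p - 1))
  rank_f : IsRankLEOne (f ^ (p - 1))

theorem exists_maximal_pow [Nontrivial V] {x : End k V} {p : ℕ} (hx : x ^ p = 0) :
    ∃ m < p, x ^ m ≠ 0 ∧ x ^ (m + 1) = 0 := by
  classical
  have hex : ∃ i, x ^ i = 0 := ⟨p, hx⟩
  have h0 : Nat.find hex ≠ 0 := by
    intro h
    have := Nat.find_spec hex
    rw [h, pow_zero] at this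
    exact one_ne_zero this
  obtain ⟨m, hm⟩ := Nat.exists_eq_succ_of_ne_zero h0
  refine ⟨m, ?_, Nat.find_min hex (by omega), ?_⟩
  · have := Nat.find_min' hex hx
    omega
  · have := Nat.find_spec hex
    rwa [hm] at this

theorem pow_eq_zero_of_succ_le {x : End k V} {m i : ℕ} (hx : x ^ (m + 1) = 0) (hi : m < i) :
    x ^ i = 0 := pow_eq_zero_of_le hi hx

namespace IsOrthSl2

variable {p : ℕ} {B : LinearMap.BilinForm k V} {e h f : End k V}

theorem swap (H : IsOrthSl2 p B e h f) : IsOrthSl2 p B f (-h) e :=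
  { H.toIsSl2.swap with
    symm := H.symm
    nondeg := H.nondeg
    skew_e := H.skew_f
    skew_h := H.skew_h.neg
    skew_f := H.skew_e
    pow_e := H.pow_f
    pow_f := H.pow_e
    rank_e := H.rank_f
    rank_f := H.rank_e }

/-- If `e ^ (p - 1) ≠ 0`, then its image is spanned by a vector of weight `p - 1`. -/
theorem h_pow_pred [CharP k p] (hp : 2 < p) (H : IsOrthSl2 p B e h f) (u : V) :
    h ((e ^ (p - 1)) u) = ((p - 1 : ℕ) : k) • (e ^ (p - 1)) u := by
  by_cases hz : (e ^ (p - 1)) u = 0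
  · simp [hz]
  have hev := even_pred_of_charP k hp
  have hcast : ((p - 1 : ℕ) : k) = -1 := by
    rw [Nat.cast_sub (by omega), CharP.cast_eq_zero]; simp
  obtain ⟨γ, hγ⟩ := H.rank_e u (h u) hz
  set z := (e ^ (p - 1)) u with hzdef
  -- Moving `h` past `e ^ (p - 1)` adds `2 (p - 1) = -2`.
  have hhz : h z = (γ - 2) • z := by
    rw [hzdef, H.h_pow_e, ← hzdef, hγ, hcast]
    module
  -- Since `e ^ (p - 1)` is self-adjoint with image the line of `z`, every `B z y` is a multiple of
  -- `B z u`; its vanishing would put `z` in the radical.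
  have hzu : B z u ≠ 0 := by
    intro h0
    refine hz (H.nondeg z fun y => ?_)
    obtain ⟨c, hc⟩ := H.rank_e u y hz
    rw [hzdef, H.skew_e.pow, hev.neg_one_pow, one_mul, hc, H.symm, ← hzdef, map_smul,
      LinearMap.smul_apply, h0, smul_zero]
  -- `B (h u) z` is computed twice: by skewness of `h`, and by self-adjointness of `e ^ (p - 1)`.
  -- Comparison gives `2 γ = 2`.
  have h1 : B (h u) z = -((γ - 2) * B z u) := by
    rw [H.skew_h, hhz, map_smul, H.symm u z, smul_eq_mul]
  have h2 : B (h u) z = γ * B z u := by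
    have := H.skew_e.pow (p - 1) (h u) u
    rw [hev.neg_one_pow, one_mul, hγ] at this
    rw [← this, map_smul, LinearMap.smul_apply, smul_eq_mul]
  have h3 : (2 * γ - 2) * B z u = 0 := by linear_combination h1 - h2
  have h4 : γ = 1 := by
    have := (mul_eq_zero.1 h3).resolve_right hzu
    have h2' := two_ne_zero_of_charP k hp
    have h5 : (2 : k) * (γ - 1) = 0 := by linear_combination this
    exact sub_eq_zero.1 ((mul_eq_zero.1 h5).resolve_left h2')
  rw [hhz, h4, hcast]
  norm_num

/-- Below `p - 1`, applying `f_pow_e` to `e ^ (m + 1) = 0` and cancelling the invertible scalar `m +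
1` determines the weight; the remaining case is `h_pow_pred`. -/
theorem h_pow_max [CharP k p] (hp : 2 < p) (H : IsOrthSl2 p B e h f) {m : ℕ} (hm : m < p)
    (he : e ^ (m + 1) = 0) (u : V) : h ((e ^ m) u) = (m : k) • (e ^ m) u := by
  rcases eq_or_ne m (p - 1) with rfl | hne
  · exact H.h_pow_pred hp u
  have h1 := H.f_pow_e m u
  rw [he] at h1
  simp only [LinearMap.zero_apply, map_zero] at h1
  have h2 : (m + 1 : k) • ((e ^ m) (h u) + (m : k) • (e ^ m) u) = 0 := by
    rw [← neg_eq_zero, h1]; module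
  have h3 := natCast_ne_zero_of_lt k (p := p) (i := m + 1) (by omega) (by omega)
  push_cast at h3
  have h4 := (smul_eq_zero.1 h2).resolve_left h3
  rw [H.h_pow_e, eq_neg_of_add_eq_zero_left h4]
  module

/-- For the swapped triple, `(e ^ m) u` is a lowest weight vector of weight `-m`. -/
theorem pow_e_pow_f_pow_e [CharP k p] (hp : 2 < p) (H : IsOrthSl2 p B e h f) {m : ℕ}
    (hm : m < p) (he : e ^ (m + 1) = 0) (u : V) :
    (e ^ m) ((f ^ m) ((e ^ m) u)) =
      (∏ j ∈ Finset.range m, ((j + 1) * (m - j) : k)) • (e ^ m) u := by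
  refine H.swap.pow_f_pow_e ?_ ?_ m
  · rw [← Module.End.mul_apply, ← pow_succ', he, LinearMap.zero_apply]
  · rw [LinearMap.neg_apply, H.h_pow_max hp hm he, neg_smul]

theorem pow_f_ne_zero [CharP k p] (hp : 2 < p) (H : IsOrthSl2 p B e h f) {m : ℕ}
    (hm : m < p) (he : e ^ (m + 1) = 0) (h0 : e ^ m ≠ 0) : f ^ m ≠ 0 := by
  intro hf
  obtain ⟨u, hu⟩ := DFunLike.ne_iff.1 h0
  have := H.pow_e_pow_f_pow_e hp hm he u
  rw [hf, LinearMap.zero_apply, map_zero] at this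
  exact (smul_ne_zero (prod_string_ne_zero k hm le_rfl) hu) this.symm

/-- If the last nonvanishing power of `f` had exponent above `m`, `pow_f_ne_zero` for the swapped
triple would make the same power of `e` nonzero. -/
theorem pow_f_eq_zero [CharP k p] (hp : 2 < p) (H : IsOrthSl2 p B e h f) {m : ℕ}
    (he : e ^ (m + 1) = 0) : f ^ (m + 1) = 0 := by
  rcases subsingleton_or_nontrivial V with _ | _
  · exact Subsingleton.elim _ _
  obtain ⟨m', hm', h0, h1⟩ := exists_maximal_pow H.pow_f
  refine pow_eq_zero_of_succ_le h1 ?_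
  by_contra hlt
  exact H.swap.pow_f_ne_zero hp hm' h1 h0 (pow_eq_zero_of_succ_le he (by omega))

end IsOrthSl2

end Sl2Operators

/-! ### Families of strings spanning non-degenerate subspaces -/

section ChainFamilies

open Module

variable {k V M : Type*} [Field k] [AddCommGroup V] [Module k V] [AddCommGroup M] [Module k M]

/-- Used to glue an explicit map on strings to one obtained by induction on the orthogonal
complement. -/
theorem exists_hom_of_isCompl {κ : Type*} {x : κ → V} (hx : LinearIndependent k x)
    {U : Submodule k V} (hU : IsCompl (Submodule.span k (Set.range x)) U) (z : κ → M)
    (T : U →ₗ[k] M) : ∃ F : V →ₗ[k] M, (∀ q, F (x q) = z q) ∧ ∀ u : U, F u = T u := by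
  refine ⟨LinearMap.ofIsCompl hU ((Basis.span hx).constr k z) T, fun q => ?_, fun u => ?_⟩
  · have h1 : x q = ((Basis.span hx q : Submodule.span k (Set.range x)) : V) := by
      rw [Basis.span_apply]
    rw [h1, LinearMap.ofIsCompl_apply_left, Basis.constr_basis]
  · rw [LinearMap.ofIsCompl_apply_right]

theorem hom_ext_of_isCompl {κ : Type*} {x : κ → V} {U : Submodule k V}
    (hU : IsCompl (Submodule.span k (Set.range x)) U) {F G : V →ₗ[k] M}
    (h1 : ∀ q, F (x q) = G (x q)) (h2 : ∀ u ∈ U, F u = G u) : F = G := by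
  rw [← LinearMap.eqLocus_eq_top, eq_top_iff, ← hU.sup_eq_top, sup_le_iff, Submodule.span_le]
  exact ⟨by rintro _ ⟨q, rfl⟩; exact h1 q, fun u hu => h2 u hu⟩

variable {ι : Type*}

/-- The vectors `v a` generate strings `v a, e (v a), …, e ^ m (v a)` that are paired with each
other by the matrix `c` in complementary degrees only. -/
def IsChainFamily (B : LinearMap.BilinForm k V) (e : End k V) (m : ℕ) (c : Matrix ι ι k)
    (v : ι → V) : Prop :=
  ∀ a b i, B (v a) ((e ^ i) (v b)) = if i = m then c a b else 0

/-- The members of the strings of length `m + 1` generated by the vectors `v a`. -/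
def chainVec (e : End k V) (m : ℕ) (v : ι → V) (q : ι × Fin (m + 1)) : V :=
  (e ^ (q.2 : ℕ)) (v q.1)

namespace IsChainFamily

variable {B : LinearMap.BilinForm k V} {e : End k V} {m : ℕ} {c : Matrix ι ι k} {v : ι → V}

theorem gram (hv : IsChainFamily B e m c v) (he : IsSkewFor B e) (a b : ι) (i j : ℕ) :
    B ((e ^ i) (v a)) ((e ^ j) (v b)) = if i + j = m then (-1) ^ i * c a b else 0 := by
  rw [he.pow, ← Module.End.mul_apply, ← pow_add, hv]
  split_ifs <;> simp

end IsChainFamily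

variable [Fintype ι]

/-- Replacing the generators of strings by `v a + ∑ b, τ a b • e ^ d (v b)`. -/
theorem gram_add_sum {B : LinearMap.BilinForm k V} {e : End k V} (he : IsSkewFor B e)
    (v : ι → V) (N : ℕ → Matrix ι ι k) (hN : ∀ i a b, B (v a) ((e ^ i) (v b)) = N i a b)
    (τ : Matrix ι ι k) (d i : ℕ) (a b : ι) :
    B (v a + ∑ b, τ a b • (e ^ d) (v b)) ((e ^ i) (v b + ∑ b', τ b b' • (e ^ d) (v b'))) =
      (N i + N (i + d) * τ.transpose + (-1 : k) ^ d • (τ * N (i + d)) +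
        (-1 : k) ^ d • (τ * N (i + d + d) * τ.transpose)) a b := by
  have h1 : ∀ a' b', B (v a') ((e ^ i) ((e ^ d) (v b'))) = N (i + d) a' b' := by
    intro a' b'
    rw [← Module.End.mul_apply, ← pow_add, hN]
  have h2 : ∀ a' b', B ((e ^ d) (v a')) ((e ^ i) (v b')) = (-1) ^ d * N (i + d) a' b' := by
    intro a' b'
    rw [he.pow, ← Module.End.mul_apply, ← pow_add, hN, add_comm]
  have h3 : ∀ a' b', B ((e ^ d) (v a')) ((e ^ i) ((e ^ d) (v b'))) =
      (-1) ^ d * N (i + d + d) a' b' := by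
    intro a' b'
    rw [he.pow, ← Module.End.mul_apply, ← Module.End.mul_apply, ← pow_add, ← pow_add, hN,
      add_comm d]
  simp only [map_add, map_sum, map_smul, LinearMap.add_apply, LinearMap.sum_apply,
    LinearMap.smul_apply, hN, h1, h2, h3, Matrix.add_apply, Matrix.mul_apply, Matrix.smul_apply,
    Matrix.transpose_apply, smul_eq_mul, mul_add, Finset.sum_add_distrib, Finset.mul_sum,
    Finset.sum_mul]
  have h4 : ∑ x, τ b x * N (i + d) a x = ∑ x, N (i + d) a x * τ b x :=
    Finset.sum_congr rfl fun _ _ => mul_comm _ _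
  have h5 : ∑ x, τ a x * ((-1) ^ d * N (i + d) x b) = ∑ x, (-1) ^ d * (τ a x * N (i + d) x b) :=
    Finset.sum_congr rfl fun _ _ => by ring
  have h6 : ∑ x, ∑ y, τ b x * (τ a y * ((-1) ^ d * N (i + d + d) y x)) =
      ∑ x, ∑ y, (-1) ^ d * (τ a y * N (i + d + d) y x * τ b x) :=
    Finset.sum_congr rfl fun _ _ => Finset.sum_congr rfl fun _ _ => by ring
  rw [h4, h5, h6]
  ring

variable [DecidableEq ι]

namespace IsChainFamily

variable {B : LinearMap.BilinForm k V} {e : End k V} {m : ℕ} {c : Matrix ι ι k} {v : ι → V}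

/-- The Gram matrix of the strings is block antidiagonal with blocks `±c`: pairing with level `m -
i` isolates the coefficients of level `i`, and `c` is invertible. -/
theorem coeff_eq_zero (hv : IsChainFamily B e m c v) (he : IsSkewFor B e) (hc : c.det ≠ 0)
    (α : ι × Fin (m + 1) → k)
    (hα : ∀ q, B (chainVec e m v q) (∑ q', α q' • chainVec e m v q') = 0) : α = 0 := by
  have key : ∀ i : Fin (m + 1), (fun b => α (b, i)) = 0 := by
    intro i
    refine Matrix.eq_zero_of_mulVec_eq_zero hc ?_
    funext a
    have h1 := hα (a, i.rev)
    simp only [map_sum, map_smul, chainVec, hv.gram he, Fintype.sum_prod_type, smul_eq_mul] at h1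
    have h2 : ∀ b : ι, (∑ j : Fin (m + 1), α (b, j) *
        (if (i.rev : ℕ) + (j : ℕ) = m then (-1) ^ (i.rev : ℕ) * c a b else 0)) =
        (-1) ^ (i.rev : ℕ) * (c a b * α (b, i)) := by
      intro b
      rw [Finset.sum_eq_single i]
      · rw [if_pos (by rw [Fin.val_rev]; omega)]; ring
      · intro j _ hj
        rw [if_neg, mul_zero]
        intro h
        apply hj
        rw [Fin.val_rev] at h
        ext
        omega
      · simp
    simp only [h2, ← Finset.mul_sum] at h1
    simpa [Matrix.mulVec, dotProduct] using h1
  funext q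
  exact congrFun (key q.2) q.1

theorem linearIndependent (hv : IsChainFamily B e m c v) (he : IsSkewFor B e) (hc : c.det ≠ 0) :
    LinearIndependent k (chainVec e m v) := by
  rw [Fintype.linearIndependent_iff]
  intro α hα q
  exact congrFun (hv.coeff_eq_zero he hc α fun q => by rw [hα, map_zero]) q

theorem isCompl [FiniteDimensional k V] (hv : IsChainFamily B e m c v) (he : IsSkewFor B e)
    (hc : c.det ≠ 0) (hs : ∀ v w, B v w = B w v) :
    IsCompl (Submodule.span k (Set.range (chainVec e m v)))
      (B.orthogonal (Submodule.span k (Set.range (chainVec e m v)))) := by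
  rw [LinearMap.BilinForm.isCompl_orthogonal_iff_disjoint (fun x y h => by rw [hs, h]),
    Submodule.disjoint_def]
  intro y hy hyo
  obtain ⟨α, rfl⟩ := (Submodule.mem_span_range_iff_exists_fun k).1 hy
  have := hv.coeff_eq_zero he hc α fun q =>
    hyo _ (Submodule.subset_span (Set.mem_range_self q))
  simp [this]

end IsChainFamily

theorem mem_orthogonal_span_range {κ : Type*} {B : LinearMap.BilinForm k V} {x : κ → V} {y : V} :
    y ∈ B.orthogonal (Submodule.span k (Set.range x)) ↔ ∀ q, B (x q) y = 0 := by
  refine ⟨fun h q => h _ (Submodule.subset_span (Set.mem_range_self q)), fun h n hn => ?_⟩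
  have : Submodule.span k (Set.range x) ≤ LinearMap.ker (B.flip y) := by
    rw [Submodule.span_le]
    rintro _ ⟨q, rfl⟩
    exact h q
  exact this hn

/-- A skew-adjoint endomorphism that stabilises a subspace stabilises its orthogonal complement. -/
theorem IsSkewFor.map_orthogonal {κ : Type*} {B : LinearMap.BilinForm k V} {y : End k V}
    (hy : IsSkewFor B y) {x : κ → V}
    (hx : ∀ q, y (x q) ∈ Submodule.span k (Set.range x)) :
    ∀ u ∈ B.orthogonal (Submodule.span k (Set.range x)),
      y u ∈ B.orthogonal (Submodule.span k (Set.range x)) := by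
  intro u hu
  rw [mem_orthogonal_span_range]
  intro q
  have h1 := hy (x q) u
  rw [hu _ (hx q)] at h1
  exact (neg_eq_zero.1 h1.symm)

theorem IsSkewFor.restrict {B : LinearMap.BilinForm k V} {y : End k V} (hy : IsSkewFor B y)
    {U : Submodule k V} (hU : ∀ u ∈ U, y u ∈ U) :
    IsSkewFor (B.restrict U) (LinearMap.restrict y hU) := fun v w => hy v w

theorem nondeg_restrict_orthogonal {B : LinearMap.BilinForm k V} {W : Submodule k V}
    (hs : ∀ v w, B v w = B w v) (hn : ∀ v, (∀ w, B v w = 0) → v = 0)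
    (hW : IsCompl W (B.orthogonal W)) (u : B.orthogonal W)
    (hu : ∀ w, B.restrict (B.orthogonal W) u w = 0) : u = 0 := by
  refine Subtype.ext (hn u fun w => ?_)
  obtain ⟨a, ha, b, hb, rfl⟩ : ∃ a ∈ W, ∃ b ∈ B.orthogonal W, a + b = w :=
    Submodule.mem_sup.1 (hW.sup_eq_top ▸ Submodule.mem_top)
  have h2 : B (u : V) b = 0 := hu ⟨b, hb⟩
  rw [map_add, h2, hs, u.2 a ha, add_zero]

theorem IsRankLEOne.restrict_pow {x : End k V} {i : ℕ} (hx : IsRankLEOne (x ^ i))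
    {U : Submodule k V} (hU : ∀ u ∈ U, x u ∈ U) :
    IsRankLEOne ((LinearMap.restrict x hU) ^ i) := by
  intro v w hv
  rw [Module.End.pow_restrict] at hv ⊢
  obtain ⟨c, hc⟩ := hx v w fun h => hv (Subtype.ext h)
  exact ⟨c, Subtype.ext hc⟩

theorem coe_restrict_pow {x : End k V} {U : Submodule k V} (hU : ∀ u ∈ U, x u ∈ U) (i : ℕ)
    (u : U) : (((LinearMap.restrict x hU) ^ i) u : V) = (x ^ i) (u : V) := by
  rw [Module.End.pow_restrict]; rfl

theorem restrict_pow_eq_zero {x : End k V} {i : ℕ} (hx : x ^ i = 0)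
    {U : Submodule k V} (hU : ∀ u ∈ U, x u ∈ U) : (LinearMap.restrict x hU) ^ i = 0 := by
  ext u
  rw [coe_restrict_pow, hx]; rfl

/-- The Gram matrix used to normalise forms of parity `m`: a line with form `(1)` if `m` is even,
and a hyperbolic plane if `m` is odd. -/
def stdGram (k : Type*) [Field k] (m : ℕ) : Σ r : ℕ, Matrix (Fin r) (Fin r) k :=
  if Even m then ⟨1, 1⟩ else ⟨2, !![0, 1; -1, 0]⟩

theorem stdGram_of_even {m : ℕ} (hm : Even m) : stdGram k m = ⟨1, 1⟩ := if_pos hm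

theorem stdGram_of_odd {m : ℕ} (hm : ¬Even m) : stdGram k m = ⟨2, !![0, 1; -1, 0]⟩ := if_neg hm

theorem stdGram_pos (m : ℕ) : 0 < (stdGram k m).1 := by
  by_cases hm : Even m
  · rw [stdGram_of_even hm]; exact one_pos
  · rw [stdGram_of_odd hm]; exact two_pos

theorem stdGram_det_ne_zero (m : ℕ) : (stdGram k m).2.det ≠ 0 := by
  by_cases hm : Even m
  · rw [stdGram_of_even hm]; simp
  · rw [stdGram_of_odd hm]; simp [Matrix.det_fin_two]

theorem stdGram_transpose (m : ℕ) :
    (stdGram k m).2.transpose = (-1 : k) ^ m • (stdGram k m).2 := by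
  by_cases hm : Even m
  · rw [stdGram_of_even hm]; simp [hm.neg_one_pow]
  · rw [stdGram_of_odd hm, (Nat.not_even_iff_odd.1 hm).neg_one_pow]
    ext i j
    fin_cases i <;> fin_cases j <;> simp

/-- For even `m`, polarisation gives a non-isotropic vector, which is rescaled by a square root. For
odd `m` the form is alternating, and any non-orthogonal pair can be rescaled. -/
theorem exists_stdGram [IsAlgClosed k] (h2 : (2 : k) ≠ 0) (m : ℕ) (β : LinearMap.BilinForm k V)
    (hβ : ∀ v w, β v w = (-1) ^ m * β w v) (h0 : ∃ v w, β v w ≠ 0) :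
    ∃ x : Fin (stdGram k m).1 → V, ∀ a b, β (x a) (x b) = (stdGram k m).2 a b := by
  by_cases hm : Even m
  · rw [stdGram_of_even hm]
    simp only [hm.neg_one_pow, one_mul] at hβ
    have h1 : ∃ v, β v v ≠ 0 := by
      by_contra! hall
      obtain ⟨v, w, hvw⟩ := h0
      have h3 := hall (v + w)
      simp only [map_add, LinearMap.add_apply, hall v, hall w, hβ w v] at h3
      exact hvw ((mul_eq_zero.1 (by linear_combination h3 : (2 : k) * β v w = 0)).resolve_left h2)
    obtain ⟨v, hv⟩ := h1
    obtain ⟨s, hs⟩ := IsAlgClosed.exists_pow_nat_eq (β v v)⁻¹ two_pos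
    refine ⟨fun _ => s • v, fun a b => ?_⟩
    rw [map_smul, map_smul, LinearMap.smul_apply, smul_smul, ← pow_two, hs, smul_eq_mul,
      inv_mul_cancel₀ hv, Subsingleton.elim a b]
    exact (Matrix.one_apply_eq b).symm
  · rw [stdGram_of_odd hm]
    simp only [(Nat.not_even_iff_odd.1 hm).neg_one_pow] at hβ
    have hself : ∀ v, β v v = 0 := fun v =>
      (mul_eq_zero.1 (by linear_combination hβ v v : (2 : k) * β v v = 0)).resolve_left h2
    obtain ⟨v, w, hvw⟩ := h0
    refine ⟨![v, (β v w)⁻¹ • w], fun a b => ?_⟩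
    fin_cases a <;> fin_cases b <;> simp [hself, hvw, hβ w v]

theorem exists_apply_pow_ne_zero {B : LinearMap.BilinForm k V} {x : End k V}
    (hs : ∀ v w, B v w = B w v) (hn : ∀ v, (∀ w, B v w = 0) → v = 0) (h0 : x ≠ 0) :
    ∃ v w, B v (x w) ≠ 0 := by
  by_contra! hall
  exact h0 (LinearMap.ext fun w => hn _ fun v => by rw [hs]; exact hall v w)

/-- The lowest weight vectors of maximal weight contain a normalised chain family. -/
theorem IsOrthSl2.exists_chainFamily [IsAlgClosed k] {p : ℕ} [CharP k p] (hp : 2 < p)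
    {B : LinearMap.BilinForm k V} {e h f : End k V} (H : IsOrthSl2 p B e h f) {m : ℕ} (hm : m < p)
    (he : e ^ (m + 1) = 0) (h0 : e ^ m ≠ 0) :
    ∃ v : Fin (stdGram k m).1 → V, IsChainFamily B e m (stdGram k m).2 v ∧
      (∀ a, f (v a) = 0) ∧ ∀ a, h (v a) = -(m : k) • v a := by
  have hf := H.pow_f_eq_zero hp he
  have hf0 := H.pow_f_ne_zero hp hm he h0
  set N : k := ∏ j ∈ Finset.range m, ((j + 1) * (m - j) : k)
  have hN : N ≠ 0 := prod_string_ne_zero k hm le_rfl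
  have hwt : ∀ x, h ((f ^ m) x) = -(m : k) • (f ^ m) x := fun x => by
    have := H.swap.h_pow_max hp hm hf x
    rw [neg_smul, ← this, LinearMap.neg_apply, neg_neg]
  have hsq : ((-1 : k) ^ m) * (-1) ^ m = 1 := by rw [← mul_pow]; simp
  have hval : ∀ x y, B ((f ^ m) x) ((e ^ m) ((f ^ m) y)) = (-1) ^ m * (N * B x ((f ^ m) y)) := by
    intro x y
    rw [H.skew_f.pow, H.swap.pow_e_pow_f_pow_e hp hm hf, map_smul, smul_eq_mul]
  -- The form `(x, y) ↦ B (f ^ m x) (e ^ m f ^ m y)` is nonzero because by `hval` it equals `± N * B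
  -- x (f ^ m y)`.
  obtain ⟨x, hx⟩ := exists_stdGram (two_ne_zero_of_charP k hp) m
    (LinearMap.BilinForm.comp B (f ^ m) ((e ^ m) * (f ^ m)))
    (by
      intro x y
      change B ((f ^ m) x) ((e ^ m) ((f ^ m) y)) = _ * B ((f ^ m) y) ((e ^ m) ((f ^ m) x))
      rw [H.symm ((f ^ m) y), H.skew_e.pow, ← mul_assoc, hsq, one_mul])
    (by
      obtain ⟨x, y, hxy⟩ := exists_apply_pow_ne_zero H.symm H.nondeg hf0
      refine ⟨x, y, ?_⟩
      change B ((f ^ m) x) ((e ^ m) ((f ^ m) y)) ≠ 0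
      rw [hval]
      exact mul_ne_zero (pow_ne_zero _ (by simp)) (mul_ne_zero hN hxy))
  refine ⟨fun a => (f ^ m) (x a), fun a b i => ?_, fun a => ?_, fun a => hwt _⟩
  · split_ifs with hi
    · subst hi; exact hx a b
    · rcases lt_or_gt_of_ne hi with hlt | hgt
      -- Vectors of weights `-m` and `2 i - m` are orthogonal, since the sum of the weights is `-2
      -- (m - i)` with `0 < m - i < p`.
      · have h1 := H.skew_h ((f ^ m) (x a)) ((e ^ i) ((f ^ m) (x b)))
        rw [H.h_pow_e, hwt, hwt, map_smul, map_smul, map_add, map_smul, map_smul,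
          LinearMap.smul_apply] at h1
        simp only [smul_eq_mul] at h1
        have h2 : (2 * ((m : k) - i)) * B ((f ^ m) (x a)) ((e ^ i) ((f ^ m) (x b))) = 0 := by
          linear_combination -h1
        have h3 := natCast_ne_zero_of_lt k (p := p) (i := m - i) (by omega) (by omega)
        rw [Nat.cast_sub hlt.le] at h3
        exact (mul_eq_zero.1 h2).resolve_left (mul_ne_zero (two_ne_zero_of_charP k hp) h3)
      · rw [pow_eq_zero_of_succ_le he hgt, LinearMap.zero_apply, map_zero]
  · rw [← Module.End.mul_apply, ← pow_succ', hf, LinearMap.zero_apply]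

/-- Strings paired correctly in top degree can be modified so that all other pairings vanish. -/
theorem exists_chainFamily_of_top {B : LinearMap.BilinForm k V} {e : End k V}
    (hs : ∀ v w, B v w = B w v) (he : IsSkewFor B e) (h2 : (2 : k) ≠ 0) {m : ℕ}
    (hm : e ^ (m + 1) = 0) {c : Matrix ι ι k} (hc : c.det ≠ 0)
    (hct : c.transpose = (-1 : k) ^ m • c) {v : ι → V}
    (hv : ∀ a b, B (v a) ((e ^ m) (v b)) = c a b) : ∃ w : ι → V, IsChainFamily B e m c w := by
  -- The pairings are corrected one degree at a time, downwards from `m`.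
  have key : ∀ t ≤ m, ∃ w : ι → V, ∀ i, m - t ≤ i → ∀ a b,
      B (w a) ((e ^ i) (w b)) = if i = m then c a b else 0 := by
    intro t
    induction t with
    | zero =>
      refine fun _ => ⟨v, fun i hi a b => ?_⟩
      split_ifs with him
      · rw [him, hv]
      · rw [pow_eq_zero_of_succ_le hm (by omega), LinearMap.zero_apply, map_zero]
    | succ t ih =>
      intro ht
      obtain ⟨w, hw⟩ := ih (by omega)
      set N : ℕ → Matrix ι ι k := fun i => Matrix.of fun a b => B (w a) ((e ^ i) (w b)) with hNdef
      have hN : ∀ i a b, B (w a) ((e ^ i) (w b)) = N i a b := fun i a b => rfl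
      have hN0 : ∀ i, m < i → N i = 0 := by
        intro i hi
        ext a b
        rw [← hN, pow_eq_zero_of_succ_le hm hi, LinearMap.zero_apply, map_zero]; rfl
      have hNm : N m = c := by
        ext a b
        rw [← hN, hw m (by omega), if_pos rfl]
      set s := m - (t + 1) with hsdef
      have hNt : (N s).transpose = (-1 : k) ^ s • N s := by
        ext a b
        rw [Matrix.transpose_apply, Matrix.smul_apply, ← hN, ← hN, hs (w b), he.pow, smul_eq_mul]
      set ε : k := (-1) ^ (t + 1) with hε
      have hεs : ε * ε = 1 := by rw [hε, ← mul_pow]; simp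
      have hsgn : ((-1 : k) ^ s) * (-1) ^ m = ε := by
        have hm' : m = s + (t + 1) := by omega
        rw [hm', pow_add, ← mul_assoc, ← mul_pow]; simp [hε]
      have hcinv : c * c⁻¹ = 1 := Matrix.mul_nonsing_inv c (isUnit_iff_ne_zero.2 hc)
      have hcinv' : c⁻¹ * c = 1 := Matrix.nonsing_inv_mul c (isUnit_iff_ne_zero.2 hc)
      have hcct : c * c⁻¹.transpose = (-1 : k) ^ m • (1 : Matrix ι ι k) := by
        have h3 : c.transpose * c⁻¹.transpose = 1 := by
          rw [← Matrix.transpose_mul, hcinv', Matrix.transpose_one]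
        rw [hct, Matrix.smul_mul] at h3
        rw [← h3, smul_smul, ← mul_pow]
        simp
      -- In degree `s = m - (t + 1)` the cross terms `c τᵀ` and `ε τ c` of `gram_add_sum` are each
      -- `-N s / 2`, so they cancel `N s`. The quadratic term involves a power of `e` above `m`, and
      -- in degrees above `s` all corrections vanish.
      set τ : Matrix ι ι k := (-(ε / 2)) • (N s * c⁻¹) with hτ
      refine ⟨fun a => w a + ∑ b, τ a b • (e ^ (t + 1)) (w b), fun i hi a b => ?_⟩
      rw [gram_add_sum he w N hN, hN0 (i + (t + 1) + (t + 1)) (by omega)]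
      rcases eq_or_lt_of_le hi with rfl | hlt
      · rw [show s + (t + 1) = m by omega, hNm, if_neg (by omega)]
        have h3 : c * τ.transpose = (-(1 / 2) : k) • N s := by
          rw [hτ, Matrix.transpose_smul, Matrix.transpose_mul, hNt, Matrix.mul_smul,
            ← Matrix.mul_assoc, hcct, Matrix.smul_mul, Matrix.one_mul, smul_smul, smul_smul]
          congr 1
          linear_combination (-(ε / 2)) * hsgn - hεs / 2
        have h4 : ε • (τ * c) = (-(1 / 2) : k) • N s := by
          rw [hτ, Matrix.smul_mul, Matrix.mul_assoc, hcinv', Matrix.mul_one, smul_smul]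
          congr 1
          linear_combination - hεs / 2
        rw [h3, h4]
        simp only [Matrix.add_apply, Matrix.smul_apply, smul_eq_mul, Matrix.mul_zero,
          Matrix.zero_mul, Matrix.zero_apply]
        field_simp
        ring
      · rw [hN0 (i + (t + 1)) (by omega)]
        simp only [Matrix.zero_mul, Matrix.mul_zero, smul_zero, add_zero]
        rw [← hN, hw i (by omega)]
  obtain ⟨w, hw⟩ := key m le_rfl
  exact ⟨w, fun a b i => hw i (by omega) a b⟩

/-- A skew-adjoint nilpotent endomorphism has a normalised chain family of maximal length. -/
theorem exists_chainFamily_of_skew [IsAlgClosed k] {B : LinearMap.BilinForm k V} {e : End k V}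
    (hs : ∀ v w, B v w = B w v) (hn : ∀ v, (∀ w, B v w = 0) → v = 0) (he : IsSkewFor B e)
    (h2 : (2 : k) ≠ 0) {m : ℕ} (hm : e ^ (m + 1) = 0) (h0 : e ^ m ≠ 0) :
    ∃ v : Fin (stdGram k m).1 → V, IsChainFamily B e m (stdGram k m).2 v := by
  obtain ⟨v, hv⟩ := exists_stdGram h2 m (LinearMap.BilinForm.comp B 1 (e ^ m))
    (fun x y => by
      change B x ((e ^ m) y) = _ * B y ((e ^ m) x)
      rw [hs x, he.pow])
    (exists_apply_pow_ne_zero hs hn h0)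
  exact exists_chainFamily_of_top hs he h2 hm (stdGram_det_ne_zero m) (stdGram_transpose m) hv

end ChainFamilies

/-! ### Existence of a triple through a given nilpotent -/

section OrthogonalTriples

open Module

theorem forall_chainVec {k V ι : Type*} [Field k] [AddCommGroup V] [Module k V] {e : End k V}
    {m : ℕ} {v : ι → V} {P : V → Prop} (h : ∀ a i, P ((e ^ i) (v a))) (q : ι × Fin (m + 1)) :
    P (chainVec e m v q) := h q.1 q.2

section Splitting

variable {k V : Type*} [Field k] [AddCommGroup V] [Module k V]

theorem pow_mem_span_chainVec {ι : Type*} {e : End k V} {m : ℕ} (hm : e ^ (m + 1) = 0) (v : ι → V)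
    (a : ι) (i : ℕ) :
    (e ^ i) (v a) ∈ Submodule.span k (Set.range (chainVec e m v)) := by
  by_cases hi : i < m + 1
  · exact Submodule.subset_span ⟨(a, ⟨i, hi⟩), rfl⟩
  · rw [pow_eq_zero_of_succ_le hm (by omega), LinearMap.zero_apply]
    exact Submodule.zero_mem _

theorem pow_map_mem {x : End k V} {U : Submodule k V} (hU : ∀ u ∈ U, x u ∈ U) (i : ℕ) :
    ∀ u ∈ U, (x ^ i) u ∈ U := fun u hu => by
  rw [← coe_restrict_pow hU i ⟨u, hu⟩]
  exact Subtype.property _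

theorem span_map_mem {κ : Type*} {y : κ → V} {x : End k V}
    (h : ∀ q, x (y q) ∈ Submodule.span k (Set.range y)) :
    ∀ u ∈ Submodule.span k (Set.range y), x u ∈ Submodule.span k (Set.range y) := by
  have : Submodule.span k (Set.range y) ≤ (Submodule.span k (Set.range y)).comap x := by
    rw [Submodule.span_le]
    rintro _ ⟨q, rfl⟩
    exact h q
  exact this

/-- Stable summands have independent images. This additivity lets equality of ranks descend to the
complements of the strings. -/
theorem finrank_range_pow_of_isCompl [FiniteDimensional k V] {x : End k V} {W U : Submodule k V}
    (hWU : IsCompl W U) (hW : ∀ w ∈ W, x w ∈ W) (hU : ∀ u ∈ U, x u ∈ U) (i : ℕ) :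
    finrank k (LinearMap.range (x ^ i)) = finrank k (W.map (x ^ i)) +
      finrank k (LinearMap.range ((LinearMap.restrict x hU) ^ i)) := by
  have h1 : (LinearMap.range ((LinearMap.restrict x hU) ^ i)).map U.subtype = U.map (x ^ i) := by
    ext y
    constructor
    · rintro ⟨_, ⟨u, rfl⟩, rfl⟩
      exact ⟨u, u.2, (coe_restrict_pow hU i u).symm⟩
    · rintro ⟨u, hu, rfl⟩
      exact ⟨_, ⟨⟨u, hu⟩, rfl⟩, coe_restrict_pow hU i _⟩
  have h2 : W.map (x ^ i) ⊓ U.map (x ^ i) = ⊥ := by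
    rw [eq_bot_iff, ← hWU.inf_eq_bot]
    refine inf_le_inf ?_ ?_
    · rintro _ ⟨w, hw, rfl⟩
      exact pow_map_mem hW i w hw
    · rintro _ ⟨w, hw, rfl⟩
      exact pow_map_mem hU i w hw
  have h3 := Submodule.finrank_sup_add_finrank_inf_eq (W.map (x ^ i)) (U.map (x ^ i))
  rw [h2, finrank_bot, add_zero, ← Submodule.map_sup, hWU.sup_eq_top, Submodule.map_top] at h3
  rw [h3, ← h1, Submodule.finrank_map_subtype_eq]

/-- Skew-adjointness can be checked on the summands of an orthogonal decomposition. -/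
theorem isSkewFor_of_isCompl {κ : Type*} {B : LinearMap.BilinForm k V} {x : κ → V}
    (hs : ∀ v w, B v w = B w v)
    (hU : IsCompl (Submodule.span k (Set.range x))
      (B.orthogonal (Submodule.span k (Set.range x)))) {T : End k V}
    (hTx : ∀ q, T (x q) ∈ Submodule.span k (Set.range x))
    (hTU : ∀ u ∈ B.orthogonal (Submodule.span k (Set.range x)),
      T u ∈ B.orthogonal (Submodule.span k (Set.range x)))
    (h1 : ∀ q q', B (T (x q)) (x q') = -B (x q) (T (x q')))
    (h2 : ∀ u ∈ B.orthogonal (Submodule.span k (Set.range x)),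
      ∀ u' ∈ B.orthogonal (Submodule.span k (Set.range x)), B (T u) u' = -B u (T u')) :
    IsSkewFor B T := by
  have hx : ∀ q, x q ∈ Submodule.span k (Set.range x) := fun q =>
    Submodule.subset_span (Set.mem_range_self q)
  have key : B ∘ₗ T = -(B.compl₂ T) := by
    refine hom_ext_of_isCompl hU (fun q => ?_) fun u hu => ?_
    · refine hom_ext_of_isCompl hU (fun q' => h1 q q') fun u hu => ?_
      change B (T (x q)) u = -B (x q) (T u)
      rw [hu _ (hTx q), hTU u hu _ (hx q), neg_zero]
    · refine hom_ext_of_isCompl hU (fun q => ?_) fun u' hu' => h2 u hu u' hu'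
      change B (T u) (x q) = -B u (T (x q))
      rw [hs, hTU u hu _ (hx q), hs, hu _ (hTx q), neg_zero]
  intro v w
  exact LinearMap.congr_fun₂ key v w

end Splitting

universe u

variable {k : Type*} [Field k] [IsAlgClosed k] {p : ℕ} [CharP k p]

/-- Induction on the dimension, splitting off the longest strings. The clause `e ^ i = 0 → f ^ i =
0` is kept for all `i`, not only `i = p`, because the rank bound for `f ^ (p - 1)` needs it on the
complement with `i = p - 1`. -/
theorem exists_sl2_of_finrank (hp : 2 < p) (N : ℕ) : ∀ (V : Type u) [AddCommGroup V] [Module k V]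
    [FiniteDimensional k V] (B : LinearMap.BilinForm k V) (e : End k V), finrank k V = N →
    (∀ v w, B v w = B w v) → (∀ v, (∀ w, B v w = 0) → v = 0) → IsSkewFor B e → e ^ p = 0 →
    IsRankLEOne (e ^ (p - 1)) → ∃ h f : End k V, IsSl2 e h f ∧ IsSkewFor B h ∧ IsSkewFor B f ∧
      (∀ i, e ^ i = 0 → f ^ i = 0) ∧ IsRankLEOne (f ^ (p - 1)) := by
  induction N using Nat.strong_induction_on with
  | _ N ih =>
  intro V _ _ _ B e hN hs hn he hep her
  have h2 := two_ne_zero_of_charP k hp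
  rcases subsingleton_or_nontrivial V with _ | _
  · refine ⟨0, 0, ⟨fun v => Subsingleton.elim _ _, fun v => Subsingleton.elim _ _,
      fun v => Subsingleton.elim _ _⟩, fun v w => by simp, fun v w => by simp,
      fun i _ => Subsingleton.elim _ _, fun v w hv => absurd (Subsingleton.elim _ _) hv⟩
  obtain ⟨m, hmp, hm0, hm1⟩ := exists_maximal_pow hep
  obtain ⟨v, hv⟩ := exists_chainFamily_of_skew hs hn he h2 hm1 hm0
  have hdet := stdGram_det_ne_zero (k := k) m
  have hli := hv.linearIndependent he hdet
  have hc := hv.isCompl he hdet hs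
  set W := Submodule.span k (Set.range (chainVec e m v)) with hWdef
  have hxW : ∀ a i, (e ^ i) (v a) ∈ W := pow_mem_span_chainVec hm1 v
  have hzero : ∀ a i, m < i → (e ^ i) (v a) = 0 := fun a i hi => by
    rw [pow_eq_zero_of_succ_le hm1 hi, LinearMap.zero_apply]
  have hes : ∀ a i, e ((e ^ i) (v a)) = (e ^ (i + 1)) (v a) := fun a i => by
    rw [pow_succ', Module.End.mul_apply]
  have heU := he.map_orthogonal (x := chainVec e m v)
    (forall_chainVec (P := fun y => e y ∈ W) fun a i => by rw [hes]; exact hxW a (i + 1))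
  rw [← hWdef] at heU
  have hWpos : 0 < finrank k W := by
    rw [hWdef, finrank_span_eq_card hli, Fintype.card_prod, Fintype.card_fin, Fintype.card_fin]
    exact Nat.mul_pos (stdGram_pos m) (Nat.succ_pos m)
  have hdim := Submodule.finrank_add_eq_of_isCompl hc
  obtain ⟨h₂, f₂, hsl, hskh, hskf, hpow, hrank⟩ := ih (finrank k (B.orthogonal W)) (by omega)
    (B.orthogonal W) (B.restrict (B.orthogonal W)) (LinearMap.restrict e heU) rfl
    (fun x y => hs x y) (nondeg_restrict_orthogonal hs hn hc) (he.restrict heU)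
    (restrict_pow_eq_zero hep heU) (her.restrict_pow heU)
  obtain ⟨h, hhx, hhU⟩ := exists_hom_of_isCompl hli hc
    (fun q => ((2 * (q.2 : ℕ) - m : k)) • chainVec e m v q) ((B.orthogonal W).subtype ∘ₗ h₂)
  -- At level `0` the truncated exponent is harmless, since the coefficient is `0`.
  obtain ⟨f, hfx, hfU⟩ := exists_hom_of_isCompl hli hc
    (fun q => (((q.2 : ℕ) : k) * (m - (q.2 : ℕ) + 1)) • (e ^ ((q.2 : ℕ) - 1)) (v q.1))
    ((B.orthogonal W).subtype ∘ₗ f₂)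
  have hh : ∀ a (i : ℕ), h ((e ^ i) (v a)) = (2 * (i : k) - m) • (e ^ i) (v a) := by
    intro a i
    by_cases hi : i < m + 1
    · exact hhx (a, ⟨i, hi⟩)
    · rw [hzero a i (by omega), map_zero, smul_zero]
  -- The formula persists past the end of the string: at `i = m + 1` the scalar vanishes, and beyond
  -- that the vectors do.
  have hf : ∀ a (i : ℕ), f ((e ^ i) (v a)) = ((i : k) * (m - i + 1)) • (e ^ (i - 1)) (v a) := by
    intro a i
    by_cases hi : i < m + 1
    · exact hfx (a, ⟨i, hi⟩)
    · rw [hzero a i (by omega), map_zero]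
      rcases eq_or_lt_of_le (not_lt.1 hi) with rfl | hlt
      · simp
      · rw [hzero a _ (by omega), smul_zero]
  have hf0 : ∀ a, f (v a) = 0 := fun a => by simpa using hf a 0
  have hfs : ∀ a (i : ℕ), f ((e ^ (i + 1)) (v a)) = (((i : k) + 1) * (m - i)) • (e ^ i) (v a) := by
    intro a i
    rw [hf, Nat.add_sub_cancel]
    push_cast
    congr 1
    ring
  have hhu : ∀ u (hu : u ∈ B.orthogonal W), h u = h₂ ⟨u, hu⟩ := fun u hu => hhU ⟨u, hu⟩
  have hfu : ∀ u (hu : u ∈ B.orthogonal W), f u = f₂ ⟨u, hu⟩ := fun u hu => hfU ⟨u, hu⟩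
  have hmemh : ∀ u ∈ B.orthogonal W, h u ∈ B.orthogonal W := fun u hu => by
    rw [hhu u hu]; exact (h₂ _).2
  have hmemf : ∀ u ∈ B.orthogonal W, f u ∈ B.orthogonal W := fun u hu => by
    rw [hfu u hu]; exact (f₂ _).2
  have hfpow : ∀ i (u : B.orthogonal W), (f ^ i) (u : V) = ((f₂ ^ i) u : B.orthogonal W) := by
    intro i
    induction i with
    | zero => intro u; rfl
    | succ i ih =>
      intro u
      rw [pow_succ, Module.End.mul_apply, hfU u, LinearMap.comp_apply, Submodule.subtype_apply,
        ih, pow_succ, Module.End.mul_apply]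
  have hfstr : ∀ a i j, i < j → (f ^ j) ((e ^ i) (v a)) = 0 := by
    intro a i
    induction i with
    | zero =>
      intro j hj
      obtain ⟨j, rfl⟩ := Nat.exists_eq_succ_of_ne_zero hj.ne'
      rw [pow_succ, Module.End.mul_apply, pow_zero, Module.End.one_apply, hf0, map_zero]
    | succ i ih =>
      intro j hj
      obtain ⟨j, rfl⟩ := Nat.exists_eq_succ_of_ne_zero (by omega : j ≠ 0)
      rw [pow_succ, Module.End.mul_apply, hfs, map_smul, ih j (by omega), smul_zero]
  have hfstr' : ∀ a i, ∃ c : k, (f ^ i) ((e ^ i) (v a)) = c • v a := by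
    intro a i
    induction i with
    | zero => exact ⟨1, by simp⟩
    | succ i ih =>
      obtain ⟨c, hc⟩ := ih
      exact ⟨_, by rw [pow_succ, Module.End.mul_apply, hfs, map_smul, hc, smul_smul]⟩
  have hgram := fun a b i j => hv.gram he a b i j
  have hpow' : ∀ i, e ^ i = 0 → f ^ i = 0 := by
    intro i hi
    have him : m < i := by
      by_contra hlt
      exact hm0 (pow_eq_zero_of_le (not_lt.1 hlt) hi)
    refine hom_ext_of_isCompl hc (fun q => ?_) fun u hu => ?_
    · exact hfstr q.1 q.2 i (by omega)
    · rw [hfpow i ⟨u, hu⟩, hpow i (restrict_pow_eq_zero hi heU)]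
      rfl
  refine ⟨h, f, ⟨fun x => ?_, fun x => ?_, fun x => ?_⟩, ?_, ?_, hpow', ?_⟩
  · refine LinearMap.congr_fun (f := h * e) (g := e * h + (2 : k) • e)
      (hom_ext_of_isCompl hc (forall_chainVec (P := fun y => h (e y) = e (h y) + (2 : k) • e y)
        fun a i => ?_) fun u hu => ?_) x
    · rw [hes, hh, hh, map_smul, hes]
      push_cast
      module
    · have := congrArg Subtype.val (hsl.h_e ⟨u, hu⟩)
      change h (e u) = e (h u) + (2 : k) • e u
      rw [hhu _ (heU u hu), hhu u hu]
      exact this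
  · refine LinearMap.congr_fun (f := h * f) (g := f * h - (2 : k) • f)
      (hom_ext_of_isCompl hc (forall_chainVec (P := fun y => h (f y) = f (h y) - (2 : k) • f y)
        fun a i => ?_) fun u hu => ?_) x
    · cases i with
      | zero => simp [hf0, show h (v a) = _ from hh a 0]
      | succ i =>
        rw [hfs, hh, map_smul, map_smul, hfs, hh]
        push_cast
        module
    · have := congrArg Subtype.val (hsl.h_f ⟨u, hu⟩)
      change h (f u) = f (h u) - (2 : k) • f u
      rw [hfu u hu, hhu u hu, hhu _ (Subtype.property _), hfu _ (Subtype.property _)]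
      exact this
  · refine LinearMap.congr_fun (f := e * f) (g := f * e + h)
      (hom_ext_of_isCompl hc (forall_chainVec (P := fun y => e (f y) = f (e y) + h y)
        fun a i => ?_) fun u hu => ?_) x
    · cases i with
      | zero =>
        rw [hes, hfs, hh, pow_zero, Module.End.one_apply, hf0, map_zero]
        push_cast
        module
      | succ i =>
        rw [hfs, hes, hfs, hh, map_smul, hes]
        push_cast
        module
    · have := congrArg Subtype.val (hsl.e_f ⟨u, hu⟩)
      change e (f u) = f (e u) + h u
      rw [hfu u hu, hhu u hu, hfu _ (heU u hu)]
      exact this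
  · refine isSkewFor_of_isCompl hs hc
      (forall_chainVec (P := fun y => h y ∈ W) fun a i => ?_) hmemh (fun q q' => ?_)
      fun u hu u' hu' => ?_
    · rw [hh]; exact W.smul_mem _ (hxW a i)
    · refine forall_chainVec (P := fun y => B (h y) _ = -B y _) (fun a i => ?_) q
      refine forall_chainVec (P := fun y => B _ y = -B _ (h y)) (fun b j => ?_) q'
      rw [hh, hh, map_smul, map_smul, LinearMap.smul_apply, hgram]
      split_ifs with hij
      · have hmk : (m : k) = i + j := by rw [← hij, Nat.cast_add]
        rw [hmk]
        simp only [smul_eq_mul]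
        ring
      · simp
    · rw [hhu u hu, hhu u' hu']
      exact hskh ⟨u, hu⟩ ⟨u', hu'⟩
  · refine isSkewFor_of_isCompl hs hc
      (forall_chainVec (P := fun y => f y ∈ W) fun a i => ?_) hmemf (fun q q' => ?_)
      fun u hu u' hu' => ?_
    · rw [hf]; exact W.smul_mem _ (hxW a _)
    · refine forall_chainVec (P := fun y => B (f y) _ = -B y _) (fun a i => ?_) q
      refine forall_chainVec (P := fun y => B _ y = -B _ (f y)) (fun b j => ?_) q'
      cases i with
      | zero =>
        cases j with
        | zero => simp [hf0]
        | succ j =>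
          rw [hfs, pow_zero, Module.End.one_apply, hf0, map_zero, LinearMap.zero_apply, map_smul]
          have := hgram a b 0 j
          rw [pow_zero, Module.End.one_apply] at this
          rw [this]
          split_ifs with hj
          · have hmk : (m : k) = j := by rw [← hj, zero_add]
            simp [hmk]
          · simp
      | succ i =>
        cases j with
        | zero =>
          rw [hfs, pow_zero, Module.End.one_apply, hf0, map_zero, map_smul, LinearMap.smul_apply]
          have := hgram a b i 0
          rw [pow_zero, Module.End.one_apply] at this
          rw [this]
          split_ifs with hj
          · have hmk : (m : k) = i := by rw [← hj, add_zero]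
            simp [hmk]
          · simp
        | succ j =>
          -- Both pairings vanish unless `i + j + 1 = m`; then both scalars equal `(i + 1) (j + 1)`,
          -- and the Gram signs differ by `-1`.
          rw [hfs, hfs, map_smul, map_smul, LinearMap.smul_apply, hgram, hgram]
          split_ifs with hij hij' hij'
          · have hmk : (m : k) = i + (j + 1) := by rw [← hij]; push_cast; ring
            rw [hmk]
            simp only [smul_eq_mul]
            ring
          · omega
          · omega
          · simp
    · rw [hfu u hu, hfu u' hu']
      exact hskf ⟨u, hu⟩ ⟨u', hu'⟩
  -- If `m = p - 1`, which is even, there is a single string. It already contains the line `e ^ (p -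
  -- 1) V`, so `e ^ (p - 1)`, and by induction `f ^ (p - 1)`, vanishes on the complement. On the
  -- string, `f ^ (p - 1)` takes values in the line of the generator.
  · rcases Nat.lt_or_ge m (p - 1) with hlt | hge
    · rw [hpow' _ (pow_eq_zero_of_succ_le hm1 hlt)]
      exact fun v w hv => absurd rfl hv
    obtain rfl : m = p - 1 := by omega
    have hr1 : (stdGram k (p - 1)).1 = 1 := by rw [stdGram_of_even (even_pred_of_charP k hp)]
    set a₀ : Fin (stdGram k (p - 1)).1 := ⟨0, stdGram_pos _⟩
    have ha : ∀ a, a = a₀ := fun a => Fin.ext (by have := a.2; have : (a₀ : ℕ) = 0 := rfl; omega)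
    have hne : (e ^ (p - 1)) (v a₀) ≠ 0 := hli.ne_zero (a₀, Fin.last (p - 1))
    have heU0 : (LinearMap.restrict e heU) ^ (p - 1) = 0 := by
      ext u
      rw [coe_restrict_pow]
      obtain ⟨c, hcu⟩ := her (v a₀) u hne
      refine Submodule.disjoint_def.1 hc.disjoint _ ?_ ?_
      · rw [hcu]; exact W.smul_mem _ (hxW _ _)
      · exact pow_map_mem heU _ _ u.2
    have hspan : LinearMap.range (f ^ (p - 1)) ≤ Submodule.span k {v a₀} := by
      rw [LinearMap.range_eq_map, ← hc.sup_eq_top, Submodule.map_sup, sup_le_iff, hWdef,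
        Submodule.map_span_le]
      constructor
      · rintro _ ⟨⟨a, i⟩, rfl⟩
        rw [ha a]
        change (f ^ (p - 1)) ((e ^ (i : ℕ)) (v a₀)) ∈ _
        rcases Nat.lt_or_ge i (p - 1) with hlt | hge
        · rw [hfstr _ _ _ hlt]; exact Submodule.zero_mem _
        · rw [show (i : ℕ) = p - 1 by omega]
          obtain ⟨c, hcv⟩ := hfstr' a₀ (p - 1)
          exact Submodule.mem_span_singleton.2 ⟨c, hcv.symm⟩
      · rintro _ ⟨u, hu, rfl⟩
        rw [hfpow _ ⟨u, hu⟩, hpow _ heU0]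
        exact Submodule.zero_mem _
    refine IsRankLEOne.of_forall (v a₀) fun x => ?_
    obtain ⟨c, hcx⟩ := Submodule.mem_span_singleton.1 (hspan ⟨x, rfl⟩)
    exact ⟨c, hcx.symm⟩

/-- Every skew-adjoint endomorphism satisfying the conditions of `¹𝒩ᵖ` extends to an
`𝔰𝔩₂`-triple of such endomorphisms. -/
theorem exists_isOrthSl2 (hp : 2 < p) {V : Type*} [AddCommGroup V] [Module k V]
    [FiniteDimensional k V] {B : LinearMap.BilinForm k V} {e : End k V}
    (hs : ∀ v w, B v w = B w v) (hn : ∀ v, (∀ w, B v w = 0) → v = 0) (he : IsSkewFor B e)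
    (hep : e ^ p = 0) (her : IsRankLEOne (e ^ (p - 1))) :
    ∃ h f : End k V, IsOrthSl2 p B e h f := by
  obtain ⟨h, f, hsl, hh, hf, hpow, hr⟩ := exists_sl2_of_finrank hp _ V B e rfl hs hn he hep her
  exact ⟨h, f, { hsl with
    symm := hs
    nondeg := hn
    skew_e := he
    skew_h := hh
    skew_f := hf
    pow_e := hep
    pow_f := hpow p hep
    rank_e := her
    rank_f := hr }⟩

end OrthogonalTriples

/-! ### Uniqueness of the triple up to isometry -/

section Isometry

open Module

/-- The images of the spans of two chain families with the same Gram matrix under powers of the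
respective endomorphisms have the same dimension. -/
theorem finrank_map_pow_chain_le {k V V' ι : Type*} [Field k] [AddCommGroup V] [Module k V]
    [AddCommGroup V'] [Module k V'] [FiniteDimensional k V]
    [Fintype ι] [DecidableEq ι] {B : LinearMap.BilinForm k V} {e : End k V} {e' : End k V'}
    {m : ℕ} {c : Matrix ι ι k} {v : ι → V} (hs : ∀ v w, B v w = B w v) (he : IsSkewFor B e)
    (hc : c.det ≠ 0) (hv : IsChainFamily B e m c v) (hm : e ^ (m + 1) = 0) (v' : ι → V')
    (hm' : e' ^ (m + 1) = 0) (i : ℕ) :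
    finrank k ((Submodule.span k (Set.range (chainVec e' m v'))).map (e' ^ i)) ≤
      finrank k ((Submodule.span k (Set.range (chainVec e m v))).map (e ^ i)) := by
  -- `F` carries strings to strings, compatibly with `e` and `e'`, so it maps one image onto a space
  -- containing the other. Exchanging the families gives the opposite inequality.
  obtain ⟨F, hF, -⟩ := exists_hom_of_isCompl (hv.linearIndependent he hc) (hv.isCompl he hc hs)
    (chainVec e' m v') 0
  have hF' : ∀ a (j : ℕ), F ((e ^ j) (v a)) = (e' ^ j) (v' a) := by
    intro a j
    by_cases hj : j < m + 1
    · exact hF (a, ⟨j, hj⟩)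
    · rw [pow_eq_zero_of_succ_le hm (by omega), pow_eq_zero_of_succ_le hm' (by omega),
        LinearMap.zero_apply, LinearMap.zero_apply, map_zero]
  have hle : (Submodule.span k (Set.range (chainVec e' m v'))).map (e' ^ i) ≤
      ((Submodule.span k (Set.range (chainVec e m v))).map (e ^ i)).map F := by
    rw [Submodule.map_span_le]
    rintro _ ⟨⟨a, j⟩, rfl⟩
    refine ⟨(e ^ i) ((e ^ (j : ℕ)) (v a)), ⟨_, pow_mem_span_chainVec hm v a j, rfl⟩, ?_⟩
    rw [← Module.End.mul_apply, ← pow_add, hF', pow_add, Module.End.mul_apply]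
    rfl
  exact (Submodule.finrank_mono hle).trans (Submodule.finrank_map_le _ _)

theorem pow_eq_zero_iff_of_finrank_range {k V V' : Type*} [Field k] [AddCommGroup V] [Module k V]
    [AddCommGroup V'] [Module k V'] [FiniteDimensional k V] [FiniteDimensional k V']
    {x : End k V} {x' : End k V'}
    (h : finrank k (LinearMap.range x) = finrank k (LinearMap.range x')) : x = 0 ↔ x' = 0 := by
  rw [← LinearMap.range_eq_bot, ← Submodule.finrank_eq_zero, h, Submodule.finrank_eq_zero,
    LinearMap.range_eq_bot]

theorem IsOrthSl2.restrict {k V : Type*} [Field k] {p : ℕ} [AddCommGroup V] [Module k V]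
    {B : LinearMap.BilinForm k V} {e h f : End k V} (H : IsOrthSl2 p B e h f) {W : Submodule k V}
    (hW : IsCompl W (B.orthogonal W)) (he : ∀ u ∈ B.orthogonal W, e u ∈ B.orthogonal W)
    (hh : ∀ u ∈ B.orthogonal W, h u ∈ B.orthogonal W)
    (hf : ∀ u ∈ B.orthogonal W, f u ∈ B.orthogonal W) :
    IsOrthSl2 p (B.restrict (B.orthogonal W)) (LinearMap.restrict e he) (LinearMap.restrict h hh)
      (LinearMap.restrict f hf) where
  h_e v := Subtype.ext (H.h_e v)
  h_f v := Subtype.ext (H.h_f v)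
  e_f v := Subtype.ext (H.e_f v)
  symm v w := H.symm v w
  nondeg := nondeg_restrict_orthogonal H.symm H.nondeg hW
  skew_e := H.skew_e.restrict he
  skew_h := H.skew_h.restrict hh
  skew_f := H.skew_f.restrict hf
  pow_e := restrict_pow_eq_zero H.pow_e he
  pow_f := restrict_pow_eq_zero H.pow_f hf
  rank_e := H.rank_e.restrict_pow he
  rank_f := H.rank_f.restrict_pow hf

universe u u'

variable {k : Type*} [Field k] [IsAlgClosed k] {p : ℕ} [CharP k p]

/-- Conjugacy of `e` and `e'` is replaced by equality of the ranks of their powers, which is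
inherited by the complements of matching strings. Two spaces are needed because these complements
differ. -/
theorem exists_isometry_of_finrank (hp : 2 < p) (N : ℕ) : ∀ (V : Type u) (V' : Type u')
    [AddCommGroup V] [Module k V] [FiniteDimensional k V]
    [AddCommGroup V'] [Module k V'] [FiniteDimensional k V']
    (B : LinearMap.BilinForm k V) (e h f : End k V) (B' : LinearMap.BilinForm k V')
    (e' h' f' : End k V'), finrank k V = N → IsOrthSl2 p B e h f → IsOrthSl2 p B' e' h' f' →
    (∀ i, finrank k (LinearMap.range (e ^ i)) = finrank k (LinearMap.range (e' ^ i))) →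
    ∃ T : V →ₗ[k] V', (∀ x y, B' (T x) (T y) = B x y) ∧ (∀ x, T (e x) = e' (T x)) ∧
      (∀ x, T (h x) = h' (T x)) ∧ ∀ x, T (f x) = f' (T x) := by
  induction N using Nat.strong_induction_on with
  | _ N ih =>
  intro V V' _ _ _ _ _ _ B e h f B' e' h' f' hN H H' hrk
  rcases subsingleton_or_nontrivial V with _ | _
  · refine ⟨0, fun x y => ?_, fun x => by simp, fun x => by simp, fun x => by simp⟩
    rw [Subsingleton.elim x 0]; simp
  obtain ⟨m, hmp, hm0, hm1⟩ := exists_maximal_pow H.pow_e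
  have hm0' : e' ^ m ≠ 0 := fun h0 => hm0 ((pow_eq_zero_iff_of_finrank_range (hrk m)).2 h0)
  have hm1' : e' ^ (m + 1) = 0 := (pow_eq_zero_iff_of_finrank_range (hrk (m + 1))).1 hm1
  -- Both triples get lowest weight generators with the same Gram matrix, so matching strings is
  -- isometric and respects `e`, `h` and `f`.
  obtain ⟨v, hv, hvf, hvh⟩ := H.exists_chainFamily hp hmp hm1 hm0
  obtain ⟨v', hv', hvf', hvh'⟩ := H'.exists_chainFamily hp hmp hm1' hm0'
  have hdet := stdGram_det_ne_zero (k := k) m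
  have hli := hv.linearIndependent H.skew_e hdet
  have hc := hv.isCompl H.skew_e hdet H.symm
  have hc' := hv'.isCompl H'.skew_e hdet H'.symm
  set W := Submodule.span k (Set.range (chainVec e m v)) with hWdef
  set W' := Submodule.span k (Set.range (chainVec e' m v')) with hWdef'
  have hxW : ∀ a i, (e ^ i) (v a) ∈ W := pow_mem_span_chainVec hm1 v
  have hxW' : ∀ a i, (e' ^ i) (v' a) ∈ W' := pow_mem_span_chainVec hm1' v'
  have hes : ∀ a i, e ((e ^ i) (v a)) = (e ^ (i + 1)) (v a) := fun a i => by
    rw [pow_succ', Module.End.mul_apply]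
  have hes' : ∀ a i, e' ((e' ^ i) (v' a)) = (e' ^ (i + 1)) (v' a) := fun a i => by
    rw [pow_succ', Module.End.mul_apply]
  have hh : ∀ a (i : ℕ), h ((e ^ i) (v a)) = (2 * (i : k) - m) • (e ^ i) (v a) := fun a i => by
    rw [H.h_pow_e, hvh, map_smul]; module
  have hh' : ∀ a (i : ℕ), h' ((e' ^ i) (v' a)) = (2 * (i : k) - m) • (e' ^ i) (v' a) :=
    fun a i => by rw [H'.h_pow_e, hvh', map_smul]; module
  have hfs : ∀ a (i : ℕ), f ((e ^ (i + 1)) (v a)) = (((i : k) + 1) * (m - i)) • (e ^ i) (v a) :=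
    fun a i => H.f_string (hvf a) (hvh a) i
  have hfs' : ∀ a (i : ℕ),
      f' ((e' ^ (i + 1)) (v' a)) = (((i : k) + 1) * (m - i)) • (e' ^ i) (v' a) :=
    fun a i => H'.f_string (hvf' a) (hvh' a) i
  have hWe : ∀ q, e (chainVec e m v q) ∈ W :=
    forall_chainVec (P := fun y => e y ∈ W) fun a i => by rw [hes]; exact hxW a (i + 1)
  have hWh : ∀ q, h (chainVec e m v q) ∈ W :=
    forall_chainVec (P := fun y => h y ∈ W) fun a i => by rw [hh]; exact W.smul_mem _ (hxW a i)
  have hWf : ∀ q, f (chainVec e m v q) ∈ W := by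
    refine forall_chainVec (P := fun y => f y ∈ W) fun a i => ?_
    cases i with
    | zero => rw [pow_zero, Module.End.one_apply, hvf]; exact W.zero_mem
    | succ i => rw [hfs]; exact W.smul_mem _ (hxW a i)
  have hWe' : ∀ q, e' (chainVec e' m v' q) ∈ W' :=
    forall_chainVec (P := fun y => e' y ∈ W') fun a i => by rw [hes']; exact hxW' a (i + 1)
  have hWh' : ∀ q, h' (chainVec e' m v' q) ∈ W' :=
    forall_chainVec (P := fun y => h' y ∈ W') fun a i => by
      rw [hh']; exact W'.smul_mem _ (hxW' a i)
  have hWf' : ∀ q, f' (chainVec e' m v' q) ∈ W' := by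
    refine forall_chainVec (P := fun y => f' y ∈ W') fun a i => ?_
    cases i with
    | zero => rw [pow_zero, Module.End.one_apply, hvf']; exact W'.zero_mem
    | succ i => rw [hfs']; exact W'.smul_mem _ (hxW' a i)
  have heU : ∀ u ∈ B.orthogonal W, e u ∈ B.orthogonal W := H.skew_e.map_orthogonal hWe
  have hhU : ∀ u ∈ B.orthogonal W, h u ∈ B.orthogonal W := H.skew_h.map_orthogonal hWh
  have hfU : ∀ u ∈ B.orthogonal W, f u ∈ B.orthogonal W := H.skew_f.map_orthogonal hWf
  have heU' : ∀ u ∈ B'.orthogonal W', e' u ∈ B'.orthogonal W' := H'.skew_e.map_orthogonal hWe'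
  have hhU' : ∀ u ∈ B'.orthogonal W', h' u ∈ B'.orthogonal W' := H'.skew_h.map_orthogonal hWh'
  have hfU' : ∀ u ∈ B'.orthogonal W', f' u ∈ B'.orthogonal W' := H'.skew_f.map_orthogonal hWf'
  have hWpos : 0 < finrank k W := by
    rw [hWdef, finrank_span_eq_card hli, Fintype.card_prod, Fintype.card_fin, Fintype.card_fin]
    exact Nat.mul_pos (stdGram_pos m) (Nat.succ_pos m)
  have hdim := Submodule.finrank_add_eq_of_isCompl hc
  obtain ⟨T₂, hT₂B, hT₂e, hT₂h, hT₂f⟩ := ih (finrank k (B.orthogonal W)) (by omega)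
    (B.orthogonal W) (B'.orthogonal W') (B.restrict (B.orthogonal W)) (LinearMap.restrict e heU)
    (LinearMap.restrict h hhU) (LinearMap.restrict f hfU) (B'.restrict (B'.orthogonal W'))
    (LinearMap.restrict e' heU') (LinearMap.restrict h' hhU') (LinearMap.restrict f' hfU') rfl
    (H.restrict hc heU hhU hfU) (H'.restrict hc' heU' hhU' hfU')
    (fun i => by
      have h1 := finrank_range_pow_of_isCompl hc (span_map_mem hWe) heU i
      have h2 := finrank_range_pow_of_isCompl hc' (span_map_mem hWe') heU' i
      have h3 := finrank_map_pow_chain_le H.symm H.skew_e hdet hv hm1 v' hm1' i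
      have h4 := finrank_map_pow_chain_le H'.symm H'.skew_e hdet hv' hm1' v hm1 i
      have h5 := hrk i
      rw [← hWdef, ← hWdef'] at h3 h4
      omega)
  obtain ⟨T, hTx, hTU⟩ := exists_hom_of_isCompl hli hc (chainVec e' m v')
    ((B'.orthogonal W').subtype ∘ₗ T₂)
  have hT : ∀ a (i : ℕ), T ((e ^ i) (v a)) = (e' ^ i) (v' a) := by
    intro a i
    by_cases hi : i < m + 1
    · exact hTx (a, ⟨i, hi⟩)
    · rw [pow_eq_zero_of_succ_le hm1 (by omega), pow_eq_zero_of_succ_le hm1' (by omega),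
        LinearMap.zero_apply, LinearMap.zero_apply, map_zero]
  have hTu : ∀ u (hu : u ∈ B.orthogonal W), T u = T₂ ⟨u, hu⟩ := fun u hu => hTU ⟨u, hu⟩
  refine ⟨T, fun x y => ?_, fun x => ?_, fun x => ?_, fun x => ?_⟩
  · refine LinearMap.congr_fun₂ (f := B'.compl₁₂ T T) (g := B) ?_ x y
    refine hom_ext_of_isCompl hc (fun q => ?_) fun u hu => ?_
    · refine hom_ext_of_isCompl hc (fun q' => ?_) fun u hu => ?_
      · change B' (T _) (T _) = _
        refine forall_chainVec (P := fun y => B' (T y) _ = B y _) (fun a i => ?_) q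
        refine forall_chainVec (P := fun y => B' _ (T y) = B _ y) (fun b j => ?_) q'
        rw [hT, hT, hv.gram H.skew_e, hv'.gram H'.skew_e]
      · change B' (T _) (T _) = _
        rw [hTx, hTu u hu, hu _ (Submodule.subset_span ⟨q, rfl⟩)]
        exact (T₂ _).2 _ (Submodule.subset_span ⟨q, rfl⟩)
    · refine hom_ext_of_isCompl hc (fun q => ?_) fun u' hu' => ?_
      · change B' (T _) (T _) = _
        rw [hTx, hTu u hu, H.symm, hu _ (Submodule.subset_span ⟨q, rfl⟩), H'.symm]
        exact (T₂ _).2 _ (Submodule.subset_span ⟨q, rfl⟩)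
      · change B' (T _) (T _) = _
        rw [hTu u hu, hTu u' hu']
        exact hT₂B _ _
  · refine LinearMap.congr_fun (f := T ∘ₗ e) (g := e' ∘ₗ T) (hom_ext_of_isCompl hc
      (forall_chainVec (P := fun y => T (e y) = e' (T y)) fun a i => ?_) fun u hu => ?_) x
    · rw [hes, hT, hT, hes']
    · change T (e u) = e' (T u)
      rw [hTu u hu, hTu _ (heU u hu)]
      exact congrArg Subtype.val (hT₂e ⟨u, hu⟩)
  · refine LinearMap.congr_fun (f := T ∘ₗ h) (g := h' ∘ₗ T) (hom_ext_of_isCompl hc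
      (forall_chainVec (P := fun y => T (h y) = h' (T y)) fun a i => ?_) fun u hu => ?_) x
    · rw [hh, map_smul, hT, hh']
    · change T (h u) = h' (T u)
      rw [hTu u hu, hTu _ (hhU u hu)]
      exact congrArg Subtype.val (hT₂h ⟨u, hu⟩)
  · refine LinearMap.congr_fun (f := T ∘ₗ f) (g := f' ∘ₗ T) (hom_ext_of_isCompl hc
      (forall_chainVec (P := fun y => T (f y) = f' (T y)) fun a i => ?_) fun u hu => ?_) x
    · cases i with
      | zero => simp [hvf, hvf', show T (v a) = _ from hT a 0]
      | succ i => rw [hfs, map_smul, hT, hT, hfs']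
    · change T (f u) = f' (T u)
      rw [hTu u hu, hTu _ (hfU u hu)]
      exact congrArg Subtype.val (hT₂f ⟨u, hu⟩)

/-- Two orthogonal `𝔰𝔩₂`-triples with conjugate nilpositive members are conjugate under an
isometry. -/
theorem exists_isometry (hp : 2 < p) {V : Type*} [AddCommGroup V] [Module k V]
    [FiniteDimensional k V] {B : LinearMap.BilinForm k V} {e h f e' h' f' : End k V}
    (H : IsOrthSl2 p B e h f) (H' : IsOrthSl2 p B e' h' f') (φ : V ≃ₗ[k] V)
    (hφ : ∀ x, φ (e x) = e' (φ x)) :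
    ∃ T : V ≃ₗ[k] V, (∀ x y, B (T x) (T y) = B x y) ∧ (∀ x, T (e x) = e' (T x)) ∧
      (∀ x, T (h x) = h' (T x)) ∧ ∀ x, T (f x) = f' (T x) := by
  have hpow : ∀ (i : ℕ) x, φ ((e ^ i) x) = (e' ^ i) (φ x) := by
    intro i
    induction i with
    | zero => intro x; rfl
    | succ i ih => intro x; rw [pow_succ, pow_succ, Module.End.mul_apply, ih, hφ]; rfl
  obtain ⟨T, hB, he, hh, hf⟩ := exists_isometry_of_finrank hp _ V V B e h f B e' h' f' rfl H H'
    (fun i => by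
      have : (LinearMap.range (e ^ i)).map (φ : V →ₗ[k] V) = LinearMap.range (e' ^ i) := by
        ext y
        constructor
        · rintro ⟨_, ⟨x, rfl⟩, rfl⟩
          exact ⟨φ x, (hpow i x).symm⟩
        · rintro ⟨x, rfl⟩
          exact ⟨_, ⟨φ.symm x, rfl⟩, by simp [hpow]⟩
      rw [← this]
      exact (LinearEquiv.finrank_map_eq φ _).symm)
  have hinj : Function.Injective T := by
    rw [injective_iff_map_eq_zero]
    intro x hx
    refine H.nondeg x fun y => ?_
    rw [← hB, hx, map_zero, LinearMap.zero_apply]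
  exact ⟨LinearEquiv.ofInjectiveEndo T hinj, hB, he, hh, hf⟩

end Isometry

/-! ### Jordan bases and the power criterion for `¹𝒩ᵖ` -/

section JordanForm

open Module

section Decomposition

variable {k : Type*} [Field k]

/-- Powers of `x` applied to a vector that is not annihilated by `x ^ m`, where `x ^ (m + 1) = 0`,
span a summand with an `x`-stable complement. -/
theorem exists_string_compl {V : Type*} [AddCommGroup V] [Module k V] {x : End k V} {m : ℕ}
    (hm : x ^ (m + 1) = 0) {v : V} (hv : (x ^ m) v ≠ 0) :
    LinearIndependent k (fun j : Fin (m + 1) => (x ^ (j : ℕ)) v) ∧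
      ∃ U : Submodule k V, (∀ u ∈ U, x u ∈ U) ∧
        IsCompl (Submodule.span k (Set.range fun j : Fin (m + 1) => (x ^ (j : ℕ)) v)) U := by
  obtain ⟨φ, hφ⟩ : ∃ φ : Dual k V, φ ((x ^ m) v) ≠ 0 := by
    by_contra! hall
    exact hv ((Module.forall_dual_apply_eq_zero_iff k _).1 hall)
  set y : Fin (m + 1) → V := fun j => (x ^ (j : ℕ)) v with hy
  set ι : (Fin (m + 1) → k) →ₗ[k] V := Fintype.linearCombination k y with hι
  -- The matrix of `Φ ∘ ι` has entries `φ (x ^ (i + j) v)`: zero for `i + j > m` and nonzero for `i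
  -- + j = m`, hence it is invertible. So `ker Φ` is a complement of the string, and it is stable
  -- because `x` shifts the coordinates of `Φ`.
  set Φ : V →ₗ[k] (Fin (m + 1) → k) := LinearMap.pi fun i => φ ∘ₗ (x ^ (i : ℕ)) with hΦ
  have hΦι : ∀ α i, Φ (ι α) i = ∑ j, α j * φ ((x ^ ((i : ℕ) + j)) v) := by
    intro α i
    simp only [hΦ, hι, hy, LinearMap.pi_apply, LinearMap.comp_apply,
      Fintype.linearCombination_apply, map_sum, map_smul, smul_eq_mul]
    refine Finset.sum_congr rfl fun j _ => ?_
    rw [pow_add, Module.End.mul_apply]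
  have hinj : Function.Injective (Φ ∘ₗ ι) := by
    rw [injective_iff_map_eq_zero]
    intro α hα
    have key : ∀ t (ht : t < m + 1), α ⟨t, ht⟩ = 0 := by
      intro t
      induction t using Nat.strong_induction_on with
      | _ t ih =>
        intro ht
        have h1 := hΦι α ⟨m - t, by omega⟩
        rw [← LinearMap.comp_apply, hα, Pi.zero_apply, Finset.sum_eq_single ⟨t, ht⟩] at h1
        · simp only [show m - t + t = m by omega] at h1
          exact (mul_eq_zero.1 h1.symm).resolve_right hφ
        · rintro ⟨j, hj⟩ _ hne
          rcases Nat.lt_or_ge j t with hlt | hge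
          · rw [ih j hlt, zero_mul]
          · have : t < j := lt_of_le_of_ne hge fun h => hne (Fin.ext h.symm)
            rw [pow_eq_zero_of_succ_le hm (by simp only; omega), LinearMap.zero_apply, map_zero,
              mul_zero]
        · intro h
          exact absurd (Finset.mem_univ _) h
    exact funext fun j => key j j.2
  have hsurj : Function.Surjective (Φ ∘ₗ ι) := LinearMap.injective_iff_surjective.1 hinj
  have hrange : LinearMap.range ι = Submodule.span k (Set.range y) :=
    Fintype.range_linearCombination k y
  refine ⟨linearIndependent_iff_injective_fintypeLinearCombination.2
    (Function.Injective.of_comp (f := Φ) hinj), LinearMap.ker Φ, fun u hu => ?_, ?_, ?_⟩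
  · rw [LinearMap.mem_ker] at hu ⊢
    funext i
    change φ ((x ^ (i : ℕ)) (x u)) = 0
    rw [← Module.End.mul_apply, ← pow_succ]
    by_cases hi : (i : ℕ) + 1 < m + 1
    · exact congrFun hu ⟨i + 1, hi⟩
    · rw [pow_eq_zero_of_succ_le hm (by omega), LinearMap.zero_apply, map_zero]
  · rw [← hrange, Submodule.disjoint_def]
    rintro _ ⟨α, rfl⟩ hα
    rw [LinearMap.mem_ker] at hα
    rw [(injective_iff_map_eq_zero (Φ ∘ₗ ι)).1 hinj α hα, map_zero]
  · rw [← hrange, codisjoint_iff, eq_top_iff]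
    intro w _
    obtain ⟨α, hα⟩ := hsurj (Φ w)
    refine Submodule.mem_sup.2 ⟨ι α, ⟨α, rfl⟩, w - ι α, ?_, by abel⟩
    rw [LinearMap.mem_ker, map_sub, ← hα, LinearMap.comp_apply, sub_self]

universe u

/-- A nilpotent endomorphism has a basis consisting of strings. -/
theorem exists_string_basis (N : ℕ) : ∀ (V : Type u) [AddCommGroup V] [Module k V]
    [FiniteDimensional k V] (x : End k V), finrank k V = N → IsNilpotent x →
    ∃ (A : Type) (_ : Fintype A) (d : A → ℕ) (w : A → V),
      (∀ a, 0 < d a) ∧ (∀ a, (x ^ d a) (w a) = 0) ∧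
      LinearIndependent k (fun q : Σ a, Fin (d a) => (x ^ (q.2 : ℕ)) (w q.1)) ∧
      Submodule.span k (Set.range fun q : Σ a, Fin (d a) => (x ^ (q.2 : ℕ)) (w q.1)) = ⊤ := by
  induction N using Nat.strong_induction_on with
  | _ N ih =>
  intro V _ _ _ x hN hx
  rcases subsingleton_or_nontrivial V with _ | _
  · exact ⟨Empty, inferInstance, fun _ => 1, Empty.elim, fun a => a.elim, fun a => a.elim,
      linearIndependent_empty_type, Subsingleton.elim _ _⟩
  obtain ⟨P, hP⟩ := hx
  obtain ⟨m, -, hm0, hm1⟩ := exists_maximal_pow hP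
  obtain ⟨v, hv⟩ := DFunLike.ne_iff.1 hm0
  obtain ⟨hli, U, hU, hc⟩ := exists_string_compl hm1 hv
  have hdim := Submodule.finrank_add_eq_of_isCompl hc
  rw [finrank_span_eq_card hli, Fintype.card_fin] at hdim
  obtain ⟨A, _, d, w, hd, hw, hliU, hspU⟩ := ih (finrank k U) (by omega) U
    (LinearMap.restrict x hU) rfl ⟨P, restrict_pow_eq_zero hP hU⟩
  obtain ⟨ρ, hfun⟩ : ∃ ρ : (Σ a, Fin (Sum.elim (fun _ : Unit => m + 1) d a)) ≃
      (Σ _ : Unit, Fin (m + 1)) ⊕ Σ a, Fin (d a),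
      (fun q : Σ a, Fin (Sum.elim (fun _ : Unit => m + 1) d a) =>
        (x ^ (q.2 : ℕ)) (Sum.elim (fun _ => v) (fun a => (w a : V)) q.1)) =
      Sum.elim (fun q : Σ _ : Unit, Fin (m + 1) => (x ^ (q.2 : ℕ)) v)
        (fun q : Σ a, Fin (d a) => (x ^ (q.2 : ℕ)) (w q.1 : V)) ∘ ρ := by
    refine ⟨Equiv.sumSigmaDistrib fun a => Fin (Sum.elim (fun _ : Unit => m + 1) d a), ?_⟩
    funext ⟨a, j⟩
    cases a <;> rfl
  have hfun1 : (fun q : Σ _ : Unit, Fin (m + 1) => (x ^ (q.2 : ℕ)) v) =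
      (fun j : Fin (m + 1) => (x ^ (j : ℕ)) v) ∘ Equiv.uniqueSigma fun _ : Unit => Fin (m + 1) := by
    funext ⟨a, j⟩
    rfl
  have hfun2 : (fun q : Σ a, Fin (d a) => (x ^ (q.2 : ℕ)) (w q.1 : V)) =
      U.subtype ∘ fun q : Σ a, Fin (d a) => ((LinearMap.restrict x hU) ^ (q.2 : ℕ)) (w q.1) := by
    funext q
    exact (coe_restrict_pow hU _ _).symm
  have hsp2 : Submodule.span k
      (Set.range fun q : Σ a, Fin (d a) => (x ^ (q.2 : ℕ)) (w q.1 : V)) = U := by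
    rw [hfun2, Set.range_comp, ← Submodule.map_span, hspU, Submodule.map_top,
      Submodule.range_subtype]
  have hsp1 : Submodule.span k
      (Set.range fun q : Σ _ : Unit, Fin (m + 1) => (x ^ (q.2 : ℕ)) v) =
      Submodule.span k (Set.range fun j : Fin (m + 1) => (x ^ (j : ℕ)) v) := by
    rw [hfun1, EquivLike.range_comp]
  refine ⟨Unit ⊕ A, inferInstance, Sum.elim (fun _ => m + 1) d,
    Sum.elim (fun _ => v) (fun a => (w a : V)), ?_, ?_, ?_, ?_⟩
  · rintro (_ | a)
    · exact Nat.succ_pos m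
    · exact hd a
  · rintro (_ | a)
    · change (x ^ (m + 1)) v = 0
      rw [hm1, LinearMap.zero_apply]
    · change (x ^ d a) (w a : V) = 0
      rw [← coe_restrict_pow hU, hw]
      rfl
  · rw [hfun, linearIndependent_equiv]
    refine LinearIndependent.sum_type ?_ ?_ ?_
    · rw [hfun1, linearIndependent_equiv]
      exact hli
    · rw [hfun2]
      exact hliU.map' _ (Submodule.ker_subtype U)
    · rw [hsp1, hsp2]
      exact hc.disjoint
  · rw [hfun, EquivLike.range_comp, Set.Sum.elim_range, Submodule.span_union, hsp1, hsp2,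
      hc.sup_eq_top]

end Decomposition

section JordanType

variable {k : Type*} [Field k] {n : ℕ}

/-- The basis `c` is a Jordan basis for `X`, with blocks of the sizes given by `L`. -/
def IsJordanBasis {V : Type*} [AddCommGroup V] [Module k V] (X : End k V) (L : List ℕ)
    (c : Basis (Σ i : Fin L.length, Fin (L.get i)) k V) : Prop :=
  ∀ i t (ht : t < L.get i), X (c ⟨i, ⟨t, ht⟩⟩) =
    if t = 0 then 0 else c ⟨i, ⟨t - 1, (Nat.sub_le _ _).trans_lt ht⟩⟩

theorem IsJordanBasis.pow {V : Type*} [AddCommGroup V] [Module k V] {X : End k V} {L : List ℕ}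
    {c : Basis (Σ i : Fin L.length, Fin (L.get i)) k V} (hc : IsJordanBasis X L c) (s : ℕ)
    (i : Fin L.length) (t : ℕ) (ht : t < L.get i) : (X ^ s) (c ⟨i, ⟨t, ht⟩⟩) =
      if s ≤ t then c ⟨i, ⟨t - s, (Nat.sub_le _ _).trans_lt ht⟩⟩ else 0 := by
  induction s generalizing t with
  | zero => simp
  | succ s ih =>
    rw [pow_succ, Module.End.mul_apply, hc]
    split_ifs with h1 h2 h2
    · omega
    · rw [map_zero]
    · rw [ih, if_pos (by omega)]
      simp only [Nat.sub_sub, add_comm 1 s]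
    · rw [ih, if_neg (by omega)]

theorem blockDiagonal_jordan_apply (L : List ℕ) (i i' : Fin L.length) (l : Fin (L.get i))
    (t : Fin (L.get i')) :
    Matrix.blockDiagonal' (fun i => nilpotentJordanBlock k (L.get i)) ⟨i, l⟩ ⟨i', t⟩ =
      if i = i' ∧ (l : ℕ) + 1 = t then 1 else 0 := by
  by_cases h : i = i'
  · subst h
    rw [Matrix.blockDiagonal'_apply_eq]
    simp [nilpotentJordanBlock]
  · rw [Matrix.blockDiagonal'_apply_ne _ _ _ h, if_neg (fun h' => h h'.1)]

theorem isJordanBasis_iff {V : Type*} [AddCommGroup V] [Module k V] {X : End k V} {L : List ℕ}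
    {c : Basis (Σ i : Fin L.length, Fin (L.get i)) k V} : IsJordanBasis X L c ↔
      ∀ q, X (c q) = ∑ r, Matrix.blockDiagonal' (fun i => nilpotentJordanBlock k (L.get i)) r q •
        c r := by
  have key : ∀ i t (ht : t < L.get i),
      ∑ r, Matrix.blockDiagonal' (fun i => nilpotentJordanBlock k (L.get i)) r ⟨i, ⟨t, ht⟩⟩ •
        c r = if t = 0 then 0 else c ⟨i, ⟨t - 1, (Nat.sub_le _ _).trans_lt ht⟩⟩ := by
    intro i t ht
    split_ifs with h0
    · refine Finset.sum_eq_zero ?_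
      rintro ⟨i', l⟩ _
      rw [blockDiagonal_jordan_apply, if_neg (by simp [h0]), zero_smul]
    · rw [Finset.sum_eq_single ⟨i, ⟨t - 1, (Nat.sub_le _ _).trans_lt ht⟩⟩]
      · rw [blockDiagonal_jordan_apply, if_pos ⟨rfl, by simp only; omega⟩, one_smul]
      · rintro ⟨i', l⟩ _ hne
        rw [blockDiagonal_jordan_apply, if_neg, zero_smul]
        rintro ⟨rfl, hl⟩
        apply hne
        simp only at hl
        congr 1
        ext
        simp only
        omega
      · intro h
        exact absurd (Finset.mem_univ _) h
  constructor
  · rintro h ⟨i, t, ht⟩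
    rw [key, h]
  · intro h i t ht
    rw [h, key]

theorem HasJordanType.exists_basis {x : Matrix (Fin n) (Fin n) k} {lam : n.Partition}
    (hx : HasJordanType x lam) : ∃ c, IsJordanBasis (Matrix.toLin' x) (partList lam) c := by
  obtain ⟨σ, g, hg⟩ := hx
  set J := Matrix.blockDiagonal' fun i => nilpotentJordanBlock k ((partList lam).get i)
  have h1 : g.1 * g⁻¹.1 = 1 := by
    rw [← Units.val_mul, mul_inv_cancel, Units.val_one]
  have h2 : g⁻¹.1 * g.1 = 1 := by
    rw [← Units.val_mul, inv_mul_cancel, Units.val_one]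
  let c := ((Pi.basisFun k (Fin n)).map (Matrix.toLin'OfInv h2 h1)).reindex σ.symm
  have hcq : ∀ q i, c q i = (g : Matrix (Fin n) (Fin n) k) i (σ q) := by
    intro q i
    simp [c, Matrix.toLin'OfInv]
  refine ⟨c, isJordanBasis_iff.2 fun q => ?_⟩
  have h3 : x * (g : Matrix (Fin n) (Fin n) k) =
      (g : Matrix (Fin n) (Fin n) k) * Matrix.reindex σ σ J := by
    rw [hg, adAction, Matrix.mul_assoc, h2, Matrix.mul_one]
  funext i
  have h4 := congrFun (congrFun h3 i) (σ q)
  rw [Matrix.mul_apply, Matrix.mul_apply, ← Equiv.sum_comp σ (fun r => g.1 i r * _)] at h4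
  simp only [Matrix.reindex_apply, Matrix.submatrix_apply, Equiv.symm_apply_apply] at h4
  rw [Matrix.toLin'_apply, Matrix.mulVec, dotProduct, Finset.sum_apply]
  simp only [Pi.smul_apply, smul_eq_mul, hcq]
  rw [h4]
  exact Finset.sum_congr rfl fun _ _ => mul_comm _ _

theorem IsJordanBasis.hasJordanType {x : Matrix (Fin n) (Fin n) k} {lam : n.Partition}
    {c : Basis (Σ i : Fin (partList lam).length, Fin ((partList lam).get i)) k (Fin n → k)}
    (hc : IsJordanBasis (Matrix.toLin' x) (partList lam) c) : HasJordanType x lam := by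
  have hcard : Fintype.card (Σ i : Fin (partList lam).length, Fin ((partList lam).get i)) = n := by
    rw [← finrank_eq_card_basis c, finrank_fin_fun]
  let σ := Fintype.equivFinOfCardEq hcard
  set b := Pi.basisFun k (Fin n)
  set c' := c.reindex σ with hc'
  let g : GL (Fin n) k := ⟨b.toMatrix c', c'.toMatrix b, b.toMatrix_mul_toMatrix_flip c',
    c'.toMatrix_mul_toMatrix_flip b⟩
  refine ⟨σ, g, ?_⟩
  have h1 : LinearMap.toMatrix c' c' (Matrix.toLin' x) = Matrix.reindex σ σ
      (Matrix.blockDiagonal' fun i => nilpotentJordanBlock k ((partList lam).get i)) := by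
    ext i j
    rw [LinearMap.toMatrix_apply, hc', Basis.reindex_apply, isJordanBasis_iff.1 hc,
      Basis.repr_reindex, Matrix.reindex_apply, Matrix.submatrix_apply]
    simp [Finsupp.single_apply]
  change x = b.toMatrix c' * _ * c'.toMatrix b
  rw [← h1, basis_toMatrix_mul_linearMap_toMatrix_mul_basis_toMatrix,
    LinearMap.toMatrix_eq_toMatrix', LinearMap.toMatrix'_toLin']

/-- Equal multisets of values mean equinumerous fibres. This matches the strings with the entries of
the sorted list of parts. -/
theorem exists_equiv_of_map_univ_eq {A A' γ : Type*} [Fintype A] [Fintype A'] [DecidableEq γ]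
    {f : A → γ} {g : A' → γ} (h : Finset.univ.val.map f = Finset.univ.val.map g) :
    ∃ τ : A ≃ A', ∀ a, g (τ a) = f a := by
  have hcard : ∀ c, Fintype.card {a // f a = c} = Fintype.card {a // g a = c} := by
    intro c
    have := congrArg (Multiset.count c) h
    rw [Multiset.count_map, Multiset.count_map] at this
    rw [Fintype.card_subtype, Fintype.card_subtype]
    simpa [Finset.card, eq_comm] using this
  exact ⟨Equiv.ofFiberEquiv fun c => Fintype.equivOfCardEq (hcard c), Equiv.ofFiberEquiv_map _⟩

/-- Every nilpotent matrix has a Jordan normal form. -/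
theorem exists_isJordanBasis {x : Matrix (Fin n) (Fin n) k} (hx : IsNilpotent x) :
    ∃ (lam : n.Partition) (c : _), IsJordanBasis (Matrix.toLin' x) (partList lam) c := by
  set X := Matrix.toLin' x with hX
  obtain ⟨P, hP⟩ := hx
  obtain ⟨A, _, d, w, hd, hw, hli, hsp⟩ := exists_string_basis _ (Fin n → k) X rfl
    ⟨P, by rw [hX, ← Matrix.toLin'_pow, hP, map_zero]⟩
  let b := Basis.mk hli hsp.ge
  have hsum : (Finset.univ.val.map d).sum = n := by
    have := finrank_eq_card_basis b
    rw [finrank_fin_fun, Fintype.card_sigma] at this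
    simpa using this.symm
  let lam : n.Partition := ⟨Finset.univ.val.map d, fun {i} hi => by
    obtain ⟨a, -, rfl⟩ := Multiset.mem_map.1 hi
    exact hd a, hsum⟩
  have hL : (Finset.univ : Finset (Fin (partList lam).length)).val.map (partList lam).get =
      Finset.univ.val.map d := by
    have h1 : ((partList lam : List ℕ) : Multiset ℕ) = Finset.univ.val.map d :=
      Multiset.sort_eq _ _
    rw [← h1]
    simp [Fin.univ_def]
  obtain ⟨τ, hτ⟩ := exists_equiv_of_map_univ_eq hL
  -- Strings are read backwards: with ones on the superdiagonal, `x` lowers the position in a block.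
  let ρ : (Σ i : Fin (partList lam).length, Fin ((partList lam).get i)) ≃ Σ a, Fin (d a) :=
    Equiv.sigmaCongr τ fun i => (finCongr (hτ i).symm).trans Fin.revPerm
  refine ⟨lam, b.reindex ρ.symm, fun i t ht => ?_⟩
  have hval : ∀ t (ht : t < (partList lam).get i), (b.reindex ρ.symm) ⟨i, ⟨t, ht⟩⟩ =
      (X ^ (d (τ i) - (t + 1))) (w (τ i)) := by
    intro t ht
    rw [Basis.reindex_apply, Equiv.symm_symm]
    simp only [b, Basis.mk_apply]
    rfl
  have hti : t < d (τ i) := by rw [hτ]; exact ht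
  rw [hval, ← Module.End.mul_apply, ← pow_succ']
  split_ifs with h0
  · rw [show d (τ i) - (t + 1) + 1 = d (τ i) by omega, hw]
  · rw [hval]
    congr 2
    omega

end JordanType

section Criterion

variable {k : Type*} [Field k] {n : ℕ}

theorem isRankLEOne_of_basis {V κ : Type*} [AddCommGroup V] [Module k V] (c : Basis κ k V)
    {T : End k V} (h : ∀ q q', T (c q) ≠ 0 → T (c q') ≠ 0 → q = q') : IsRankLEOne T := by
  by_cases hall : ∀ q, T (c q) = 0
  · intro v w hv
    exact absurd (LinearMap.congr_fun (c.ext (f₁ := T) (f₂ := 0) hall) v) hv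
  · push Not at hall
    obtain ⟨q₀, hq₀⟩ := hall
    have hle : LinearMap.range T ≤ Submodule.span k {T (c q₀)} := by
      rw [LinearMap.range_eq_map, ← c.span_eq, Submodule.map_span_le]
      rintro _ ⟨q, rfl⟩
      by_cases hq : T (c q) = 0
      · rw [hq]; exact Submodule.zero_mem _
      · rw [h q q₀ hq hq₀]; exact Submodule.mem_span_singleton_self _
    refine IsRankLEOne.of_forall (T (c q₀)) fun v => ?_
    obtain ⟨a, ha⟩ := Submodule.mem_span_singleton.1 (hle ⟨v, rfl⟩)
    exact ⟨a, ha.symm⟩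

theorem partList_antitone (lam : n.Partition) {i j : ℕ} (hij : i ≤ j)
    (hj : j < (partList lam).length) : (partList lam)[j] ≤ (partList lam)[i] := by
  rcases eq_or_lt_of_le hij with rfl | hlt
  · exact le_rfl
  · exact List.pairwise_iff_getElem.1 (Multiset.pairwise_sort lam.parts (· ≥ ·)) i j _ hj hlt

/-- Membership in `¹𝒩ᵖ` in terms of the powers of a matrix. -/
theorem mem_oneNp_iff {𝔤 : LieSubalgebra k (Matrix (Fin n) (Fin n) k)} {p : ℕ} (hp : 0 < p)
    {x : Matrix (Fin n) (Fin n) k} : x ∈ oneNp 𝔤 p ↔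
      x ∈ 𝔤 ∧ (Matrix.toLin' x) ^ p = 0 ∧ IsRankLEOne ((Matrix.toLin' x) ^ (p - 1)) := by
  constructor
  · rintro ⟨⟨hx, -⟩, lam, hlam, h1, h2⟩
    obtain ⟨c, hc⟩ := hlam.exists_basis
    have hle : ∀ i : Fin (partList lam).length, (partList lam).get i ≤ p := fun i => by
      refine (partList_antitone lam (Nat.zero_le i) i.2).trans ?_
      simpa [nthPart, i.pos] using h1
    have hlt : ∀ i : Fin (partList lam).length, 0 < (i : ℕ) → (partList lam).get i < p :=
      fun i hi => by
        refine (partList_antitone lam (Nat.succ_le_of_lt hi) i.2).trans_lt ?_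
        have : 1 < (partList lam).length := by omega
        simpa [nthPart, this] using h2
    refine ⟨hx, c.ext ?_, isRankLEOne_of_basis c ?_⟩
    · rintro ⟨i, t, ht⟩
      have := hle i
      rw [hc.pow, if_neg (by omega), LinearMap.zero_apply]
    · rintro ⟨i, t, ht⟩ ⟨i', t', ht'⟩ hq hq'
      rw [hc.pow, ne_eq, ite_eq_right_iff, not_forall] at hq hq'
      obtain ⟨hq, -⟩ := hq
      obtain ⟨hq', -⟩ := hq'
      have hi : i = i' := by
        have h3 : (i : ℕ) = 0 := by
          by_contra h0
          have := hlt i (by omega)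
          omega
        have h4 : (i' : ℕ) = 0 := by
          by_contra h0
          have := hlt i' (by omega)
          omega
        exact Fin.ext (h3.trans h4.symm)
      subst hi
      have := hle i
      have ht : t = t' := by omega
      subst ht
      rfl
  · rintro ⟨hx, hpow, hrank⟩
    have hnil : IsNilpotent x := ⟨p, by
      rw [← Matrix.toLin'_pow] at hpow
      exact (LinearEquiv.map_eq_zero_iff _).1 hpow⟩
    obtain ⟨lam, c, hc⟩ := exists_isJordanBasis hnil
    have hpos : ∀ i : Fin (partList lam).length, 0 < (partList lam).get i := fun i =>
      lam.parts_pos ((Multiset.mem_sort (· ≥ ·)).1 (List.get_mem (partList lam) i))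
    have hle : ∀ i : Fin (partList lam).length, (partList lam).get i ≤ p := fun i => by
      by_contra hlt
      have h1 := hc.pow p i p (by omega)
      rw [hpow, LinearMap.zero_apply, if_pos le_rfl] at h1
      exact c.ne_zero _ h1.symm
    refine ⟨⟨hx, hnil⟩, lam, hc.hasJordanType, ?_, ?_⟩
    · by_cases h0 : 0 < (partList lam).length
      · simpa [nthPart, h0] using hle ⟨0, h0⟩
      · rw [nthPart, List.getD_eq_default _ _ (by omega)]
        exact Nat.zero_le _
    · by_cases h0 : 1 < (partList lam).length
      · have h1 : nthPart lam 2 = (partList lam).get ⟨1, h0⟩ := by simp [nthPart, h0]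
        rw [h1]
        -- If `λ₂ = p` then `λ₁ = p`, and `x ^ (p - 1)` sends the last vectors of these two blocks
        -- to their distinct first basis vectors, contradicting rank one.
        refine lt_of_le_of_ne (hle _) fun heq => ?_
        have heq0 : (partList lam).get ⟨0, by omega⟩ = p :=
          le_antisymm (hle _) (heq.symm.le.trans (partList_antitone lam (Nat.zero_le 1) h0))
        have e0 := hc.pow (p - 1) ⟨0, by omega⟩ (p - 1) (by omega)
        have e1 := hc.pow (p - 1) ⟨1, h0⟩ (p - 1) (by omega)
        rw [if_pos le_rfl] at e0 e1
        obtain ⟨a, ha⟩ := hrank (c ⟨⟨0, by omega⟩, ⟨p - 1, by omega⟩⟩)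
          (c ⟨⟨1, h0⟩, ⟨p - 1, by omega⟩⟩) (by rw [e0]; exact c.ne_zero _)
        rw [e0, e1] at ha
        have h2 := congrArg (fun y => c.repr y ⟨⟨1, h0⟩, ⟨p - 1 - (p - 1), by omega⟩⟩) ha
        simp at h2
      · rw [nthPart, List.getD_eq_default _ _ (by omega)]
        exact hp

end Criterion

end JordanForm

/-! ### Passage between matrices and operators -/

section MatrixTranslation

open Module Matrix

variable {k : Type*} [Field k] {n : ℕ}

theorem mem_skewAdjoint_iff_isSkewFor {S x : Matrix (Fin n) (Fin n) k} :
    x ∈ skewAdjointMatricesLieSubalgebra S ↔ IsSkewFor (toBilin' S) (toLin' x) := by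
  rw [mem_skewAdjointMatricesLieSubalgebra, mem_skewAdjointMatricesSubmodule]
  change xᵀ * S = S * -x ↔ _
  have h1 : ∀ v w, toBilin' S (toLin' x v) w = toBilin' (xᵀ * S) v w := fun v w => by
    have := LinearMap.congr_fun₂ (toBilin'_comp S x 1) v w
    rw [Matrix.mul_one] at this
    rw [← this, toLin'_one]
    rfl
  have h2 : ∀ v w, -toBilin' S v (toLin' x w) = toBilin' (S * -x) v w := fun v w => by
    have := LinearMap.congr_fun₂ (toBilin'_comp S 1 x) v w
    rw [Matrix.transpose_one, Matrix.one_mul, toLin'_one] at this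
    rw [Matrix.mul_neg, map_neg, LinearMap.neg_apply, LinearMap.neg_apply, ← this]
    rfl
  constructor
  · intro h v w
    rw [h1, h2, h]
  · intro h
    refine toBilin'.injective (LinearMap.ext₂ fun v w => ?_)
    rw [← h1, ← h2, h]

theorem mem_orthogonalGroupOf_iff {S : Matrix (Fin n) (Fin n) k} {g : GL (Fin n) k} :
    g ∈ orthogonalGroupOf S ↔ ∀ v w, toBilin' S (toLin' g.1 v) (toLin' g.1 w) = toBilin' S v w := by
  change g.1ᵀ * S * g.1 = S ↔ _
  have h1 : ∀ v w, toBilin' S (toLin' g.1 v) (toLin' g.1 w) = toBilin' (g.1ᵀ * S * g.1) v w :=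
    fun v w => LinearMap.congr_fun₂ (toBilin'_comp S g.1 g.1) v w
  constructor
  · intro h v w
    rw [h1, h]
  · intro h
    refine toBilin'.injective (LinearMap.ext₂ fun v w => ?_)
    rw [← h1, h]

theorem toBilin'_symm {S : Matrix (Fin n) (Fin n) k} (hS : S.IsSymm) (v w : Fin n → k) :
    toBilin' S v w = toBilin' S w v := by
  rw [toBilin'_apply', toBilin'_apply', dotProduct_mulVec, ← mulVec_transpose, hS.eq,
    dotProduct_comm]

theorem toBilin'_nondeg {S : Matrix (Fin n) (Fin n) k} (hdet : IsUnit S.det) (v : Fin n → k)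
    (hv : ∀ w, toBilin' S v w = 0) : v = 0 := by
  refine eq_zero_of_vecMul_eq_zero hdet.ne_zero (dotProduct_eq_zero _ fun w => ?_)
  rw [← dotProduct_mulVec, ← toBilin'_apply', hv]

theorem adAction_eq_iff {g : GL (Fin n) k} {x y : Matrix (Fin n) (Fin n) k} :
    adAction g x = y ↔ ∀ v, toLin' g.1 (toLin' x v) = toLin' y (toLin' g.1 v) := by
  have h1 : adAction g x = y ↔ g.1 * x = y * g.1 := by
    rw [adAction]
    exact Units.mul_inv_eq_iff_eq_mul g
  rw [h1, ← toLin'.injective.eq_iff, toLin'_mul, toLin'_mul, LinearMap.ext_iff]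
  rfl

theorem lie_eq_iff {x y z : Matrix (Fin n) (Fin n) k} :
    ⁅x, y⁆ = z ↔ ∀ v, toLin' x (toLin' y v) = toLin' y (toLin' x v) + toLin' z v := by
  rw [LieRing.of_associative_ring_bracket, sub_eq_iff_eq_add', ← toLin'.injective.eq_iff, map_add,
    toLin'_mul, toLin'_mul, LinearMap.ext_iff]
  rfl

theorem isSl2TripleIn_iff {S e h f : Matrix (Fin n) (Fin n) k} :
    IsSl2TripleIn (skewAdjointMatricesLieSubalgebra S) e h f ↔
      IsSkewFor (toBilin' S) (toLin' e) ∧ IsSkewFor (toBilin' S) (toLin' h) ∧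
      IsSkewFor (toBilin' S) (toLin' f) ∧ IsSl2 (toLin' e) (toLin' h) (toLin' f) := by
  simp only [← mem_skewAdjoint_iff_isSkewFor]
  constructor
  · rintro ⟨h1, h2, h3, h4, h5, h6⟩
    refine ⟨h1, h2, h3, fun v => ?_, fun v => ?_, fun v => ?_⟩
    · rw [lie_eq_iff.1 h4, map_smul, LinearMap.smul_apply]
    · rw [lie_eq_iff.1 h5, map_neg, map_smul, LinearMap.neg_apply, LinearMap.smul_apply,
        sub_eq_add_neg]
    · rw [lie_eq_iff.1 h6]
  · rintro ⟨h1, h2, h3, h4⟩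
    refine ⟨h1, h2, h3, lie_eq_iff.2 fun v => ?_, lie_eq_iff.2 fun v => ?_,
      lie_eq_iff.2 fun v => ?_⟩
    · rw [h4.h_e, map_smul, LinearMap.smul_apply]
    · rw [h4.h_f, map_neg, map_smul, LinearMap.neg_apply, LinearMap.smul_apply, sub_eq_add_neg]
    · rw [h4.e_f]

theorem Sl2TripleIn.isOrthSl2 {S : Matrix (Fin n) (Fin n) k} {p : ℕ} (hp : 0 < p) (hS : S.IsSymm)
    (hdet : IsUnit S.det) (t : Sl2TripleIn (skewAdjointMatricesLieSubalgebra S)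
      (oneNp (skewAdjointMatricesLieSubalgebra S) p)) :
    IsOrthSl2 p (toBilin' S) (toLin' t.e) (toLin' t.h) (toLin' t.f) := by
  obtain ⟨h1, h2, h3, h4⟩ := isSl2TripleIn_iff.1 t.isTriple
  obtain ⟨-, he, her⟩ := (mem_oneNp_iff hp).1 t.e_mem
  obtain ⟨-, hf, hfr⟩ := (mem_oneNp_iff hp).1 t.f_mem
  exact { h4 with
    symm := toBilin'_symm hS
    nondeg := toBilin'_nondeg hdet
    skew_e := h1
    skew_h := h2
    skew_f := h3
    pow_e := he
    pow_f := hf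
    rank_e := her
    rank_f := hfr }

theorem adAction_mem_oneNp {S : Matrix (Fin n) (Fin n) k} {p : ℕ} {g : GL (Fin n) k}
    (hg : g ∈ orthogonalGroupOf S) {x : Matrix (Fin n) (Fin n) k}
    (hx : x ∈ oneNp (skewAdjointMatricesLieSubalgebra S) p) :
    adAction g x ∈ oneNp (skewAdjointMatricesLieSubalgebra S) p := by
  obtain ⟨⟨hxs, s, hs⟩, lam, ⟨σ, g', hx'⟩, h1, h2⟩ := hx
  refine ⟨⟨?_, s, ?_⟩, lam, ⟨σ, g * g', ?_⟩, h1, h2⟩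
  · rw [mem_skewAdjoint_iff_isSkewFor] at hxs ⊢
    have hg' := mem_orthogonalGroupOf_iff.1 hg
    have hsurj : ∀ v, ∃ w, toLin' g.1 w = v := fun v => ⟨toLin' g⁻¹.1 v, by
      rw [← toLin'_mul_apply, ← Units.val_mul, mul_inv_cancel, Units.val_one, toLin'_one,
        LinearMap.id_apply]⟩
    have hact := adAction_eq_iff.1 (rfl : adAction g x = adAction g x)
    intro v w
    obtain ⟨v, rfl⟩ := hsurj v
    obtain ⟨w, rfl⟩ := hsurj w
    rw [← hact, ← hact, hg', hg', hxs]
  · rw [adAction, Units.conj_pow, hs, Matrix.mul_zero, Matrix.zero_mul]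
  · rw [hx', adAction_mul]

/-- A matrix has rank at most one if and only if its `2 × 2` minors vanish. -/
theorem isRankLEOne_toLin'_iff {M : Matrix (Fin n) (Fin n) k} :
    IsRankLEOne (toLin' M) ↔ ∀ i j l q, M i j * M l q - M i q * M l j = 0 := by
  constructor
  · intro h i j l q
    by_cases hj : toLin' M (Pi.single j 1) = 0
    · have h0 : ∀ r, M r j = 0 := fun r => by simpa using congrFun hj r
      rw [h0, h0]
      ring
    · obtain ⟨c, hc⟩ := h (Pi.single j 1) (Pi.single q 1) hj
      have h0 : ∀ r, M r q = c * M r j := fun r => by simpa using congrFun hc r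
      rw [h0, h0]
      ring
  · intro h v w hv
    obtain ⟨l, hl⟩ := Function.ne_iff.1 hv
    rw [Pi.zero_apply] at hl
    refine ⟨toLin' M w l / toLin' M v l, ?_⟩
    -- The difference of the two sides is a linear combination of `2 × 2` minors with coefficients
    -- `w j * v q`.
    have key : ∀ i, toLin' M w i * toLin' M v l = toLin' M w l * toLin' M v i := by
      intro i
      simp only [toLin'_apply, mulVec, dotProduct, Finset.sum_mul_sum]
      rw [Finset.sum_congr rfl fun j _ => Finset.sum_congr rfl fun q _ => ?_]
      linear_combination w j * v q * h i j l q
    funext i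
    rw [Pi.smul_apply, smul_eq_mul, div_mul_eq_mul_div, eq_div_iff hl, key]

theorem isZariskiClosed_of_forall {𝒱 : Set (Matrix (Fin n) (Fin n) k)}
    (P : Set (MvPolynomial (Fin n × Fin n) k))
    (h : ∀ x, x ∈ 𝒱 ↔ ∀ f ∈ P, MvPolynomial.aeval (fun ij : Fin n × Fin n => x ij.1 ij.2) f = 0) :
    IsZariskiClosed 𝒱 := by
  refine ⟨Ideal.span P, Set.ext fun x => ?_⟩
  rw [h, Set.mem_ofPred_eq, MvPolynomial.zeroLocus_span]
  rfl

/-- The equations are the linear ones for skewness, the entries of `X ^ p`, and the `2 × 2` minors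
of `X ^ (p - 1)` for the generic matrix `X`. -/
theorem isZariskiClosed_oneNp (S : Matrix (Fin n) (Fin n) k) {p : ℕ} (hp : 0 < p) :
    IsZariskiClosed (oneNp (skewAdjointMatricesLieSubalgebra S) p) := by
  set X := mvPolynomialX (Fin n) (Fin n) k with hX
  let C : k →+* MvPolynomial (Fin n × Fin n) k := MvPolynomial.C
  let Y : Matrix (Fin n) (Fin n) (MvPolynomial (Fin n × Fin n) k) := Xᵀ * S.map C + S.map C * X
  refine isZariskiClosed_of_forall
    (Set.range (fun q : Fin n × Fin n => Y q.1 q.2) ∪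
      Set.range (fun q : Fin n × Fin n => (X ^ p) q.1 q.2) ∪
      Set.range (fun q : (Fin n × Fin n) × (Fin n × Fin n) =>
        (X ^ (p - 1)) q.1.1 q.1.2 * (X ^ (p - 1)) q.2.1 q.2.2 -
          (X ^ (p - 1)) q.1.1 q.2.2 * (X ^ (p - 1)) q.2.1 q.1.2)) fun x => ?_
  set ψ := MvPolynomial.aeval (R := k) (fun ij : Fin n × Fin n => x ij.1 ij.2) with hψ
  have hψX : ∀ i j, ψ (X i j) = x i j := fun i j => by
    rw [hX, mvPolynomialX_apply, hψ, MvPolynomial.aeval_X]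
  have hψC : ∀ a, ψ (MvPolynomial.C a) = a := fun a => by
    rw [hψ, MvPolynomial.aeval_C]; rfl
  have hpow : ∀ (s : ℕ) i j, ψ ((X ^ s) i j) = (x ^ s) i j := by
    intro s i j
    have h1 : ψ.mapMatrix (X ^ s) = x ^ s := by
      rw [map_pow]
      congr 1
      ext i j
      exact hψX i j
    rw [← h1]
    rfl
  have hlin : ∀ i j, ψ (Y i j) = (xᵀ * S + S * x) i j := by
    intro i j
    simp [Y, C, Matrix.add_apply, Matrix.mul_apply, hψX, hψC]
  rw [mem_oneNp_iff hp, ← toLin'_pow, ← toLin'_pow, LinearEquiv.map_eq_zero_iff,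
    isRankLEOne_toLin'_iff, mem_skewAdjointMatricesLieSubalgebra,
    mem_skewAdjointMatricesSubmodule]
  change xᵀ * S = S * -x ∧ _ ↔ _
  rw [Matrix.mul_neg, eq_neg_iff_add_eq_zero, ← Matrix.ext_iff, ← Matrix.ext_iff]
  simp only [Set.union_def, Set.mem_ofPred_eq, or_imp, forall_and, Set.forall_mem_range, Prod.forall,
    map_sub, map_mul, hpow, hlin, Matrix.zero_apply, and_assoc]

theorem exists_gl_of_linearEquiv (T : (Fin n → k) ≃ₗ[k] (Fin n → k)) :
    ∃ g : GL (Fin n) k, ∀ v, toLin' g.1 v = T v := by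
  refine ⟨⟨LinearMap.toMatrix' T.toLinearMap, LinearMap.toMatrix' T.symm.toLinearMap, ?_, ?_⟩,
    fun v => ?_⟩
  · rw [← LinearMap.toMatrix'_comp]
    simp
  · rw [← LinearMap.toMatrix'_comp]
    simp
  · rw [toLin'_toMatrix']
    rfl

/-- Linear conjugacy of the nilpositive members suffices: `exists_isometry` supplies a new
orthogonal element conjugating the whole triples. -/
theorem kostantMap_injective [IsAlgClosed k] {p : ℕ} [CharP k p] (hp : 2 < p)
    {S : Matrix (Fin n) (Fin n) k} (hS : S.IsSymm) (hdet : IsUnit S.det) :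
    Function.Injective (kostantMap (orthogonalGroupOf S) (skewAdjointMatricesLieSubalgebra S)
      (oneNp (skewAdjointMatricesLieSubalgebra S) p)) := by
  intro a b
  induction a using Quotient.inductionOn with
  | _ s =>
  induction b using Quotient.inductionOn with
  | _ t =>
  intro hst
  obtain ⟨g, -, hg⟩ := Quotient.exact hst
  change adAction g s.e = t.e at hg
  have h1 : g.1 * g⁻¹.1 = 1 := by rw [← Units.val_mul, mul_inv_cancel, Units.val_one]
  have h2 : g⁻¹.1 * g.1 = 1 := by rw [← Units.val_mul, inv_mul_cancel, Units.val_one]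
  obtain ⟨T, hB, he, hh, hf⟩ := exists_isometry hp (s.isOrthSl2 (by omega) hS hdet)
    (t.isOrthSl2 (by omega) hS hdet) (toLin'OfInv h2 h1) (adAction_eq_iff.1 hg)
  obtain ⟨g', hg'⟩ := exists_gl_of_linearEquiv T
  refine Quotient.sound ⟨g', mem_orthogonalGroupOf_iff.2 fun v w => ?_,
    adAction_eq_iff.2 fun v => ?_, adAction_eq_iff.2 fun v => ?_, adAction_eq_iff.2 fun v => ?_⟩
  · rw [hg', hg', hB]
  · rw [hg', hg', he]
  · rw [hg', hg', hh]
  · rw [hg', hg', hf]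

theorem kostantMap_surjective [IsAlgClosed k] {p : ℕ} [CharP k p] (hp : 2 < p)
    {S : Matrix (Fin n) (Fin n) k} (hS : S.IsSymm) (hdet : IsUnit S.det) :
    Function.Surjective (kostantMap (orthogonalGroupOf S) (skewAdjointMatricesLieSubalgebra S)
      (oneNp (skewAdjointMatricesLieSubalgebra S) p)) := by
  intro b
  induction b using Quotient.inductionOn with
  | _ x =>
  obtain ⟨x, hx⟩ := x
  obtain ⟨hxs, hxp, hxr⟩ := (mem_oneNp_iff (by omega)).1 hx
  obtain ⟨h, f, H⟩ := exists_isOrthSl2 hp (toBilin'_symm hS) (toBilin'_nondeg hdet)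
    (mem_skewAdjoint_iff_isSkewFor.1 hxs) hxp hxr
  obtain ⟨h, rfl⟩ := toLin'.surjective h
  obtain ⟨f, rfl⟩ := toLin'.surjective f
  exact ⟨Quotient.mk _ ⟨x, h, f, isSl2TripleIn_iff.2 ⟨H.skew_e, H.skew_h, H.skew_f, H.toIsSl2⟩, hx,
    (mem_oneNp_iff (by omega)).2 ⟨mem_skewAdjoint_iff_isSkewFor.2 H.skew_f, H.pow_f, H.rank_f⟩⟩, rfl⟩

end MatrixTranslation

theorem proposition4p5 {k : Type*} [Field k] [IsAlgClosed k] (p : ℕ) [CharP k p] (hp : 2 < p)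
    (n : ℕ) (S : Matrix (Fin n) (Fin n) k) (hS : S.IsSymm) (hdet : IsUnit S.det) :
    HasSl2Property (orthogonalGroupOf S) (skewAdjointMatricesLieSubalgebra S)
      (oneNp (skewAdjointMatricesLieSubalgebra S) p) where
  subset_nilpotentCone _ hx := hx.1
  stable _ hg _ hx := adAction_mem_oneNp hg hx
  closed := isZariskiClosed_oneNp S (by omega)
  bijective := ⟨kostantMap_injective hp hS hdet, kostantMap_surjective hp hS hdet⟩
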